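/- Let $(M,\eta)$ be a smooth pseudo-Riemannian manifold of dimension $m$, let $\Sigma$ be an $n$-dimensional (immersed) submanifold whose induced metric $g$ is nondegenerate, let $\bar\nabla$ be the Levi-Civita connection of $\eta$, with Christoffel symbols $\bar\Gamma^i_{jk}$, and let $N$ be a smooth normal vector field along $\Sigma$. For a tangent vector $X$ of $\Sigma$ write $\bar\nabla_XN=-W_N(X)+D_XN$ with $W_N(X)\in T\Sigma$ (the Weingarten map) and $D_XN\in T\Sigma^\perp$ (the normal connection). In local coordinates $x^1,\dots,x^m$ on $M$ and $u^1,\dots,u^n$ on $\Sigma$, set $g_{ab}=\eta(e_a,e_b)$ with $e_a=(\partial_ax^i)\partial_i$, and $$\mathcal D^i(f)=g^{ab}(\partial_ax^i)(\partial_bf),\qquad \mathcal D^{ij}=\mathcal D^i(x^j),\qquad \hat\nabla^iN^j=\mathcal D^i(N^j)+\mathcal D^{ik}\bar\Gamma^j_{kl}N^l,$$ $$\mathcal B_N^{ij}=-\hat\nabla^iN^j,\qquad \mathcal B_N(Y)=\mathcal B_N^{ij}\eta_{jk}Y^k\partial_i\quad\text{for } Y\in TM .$$ Then the following hold. (i)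 Let $r\ge 0$ and let $\{\cdot,\dots,\cdot\}$ be an $(r+1)$-multilinear map on $C^\infty(\Sigma)$ with values in $C^\infty(\Sigma)$ that satisfies the Leibniz rule in each argument (so that it may be evaluated on locally defined functions). For $I=(i_1,\dots,i_r)$ put $\{f,\vec x^I\}=\{f,x^{i_1},\dots,x^{i_r}\}$ and $\eta_{IJ}=\eta_{i_1j_1}\cdots\eta_{i_rj_r}$. If there are $0<\gamma\in C^\infty(\Sigma)$ and $\epsilon\in\{-1,1\}$ with $$\tfrac1{r!}\{x^i,\vec x^I\}\{x^j,\vec x^J\}\eta_{IJ}=\epsilon\gamma^2g^{ab}(\partial_ax^i)(\partial_bx^j)$$ in all local coordinates, then $$\mathcal B_N^{ij}=-\frac{\epsilon}{\gamma^2r!}\{x^i,\vec x^I\}\{N^j,\vec x^J\}\eta_{IJ}-\frac{\epsilon}{\gamma^2r!}\{x^i,\vec x^I\}\{x^k,\vec x^J\}\eta_{IJ}\bar\Gamma^j_{kl}N^l .$$ (ii) $\mathcal B_N(Y)\in T\Sigma$ for every $Y\in TM$ at a point of $\Sigma$. (iii) $\mathcal B_N(X)=W_N(X)$ for every $X\in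 T\Sigma$. (iv) $\eta(\mathcal B_N(\tilde N),X)=-\eta(D_XN,\tilde N)$ for every $X\in T\Sigma$ and $\tilde N\in T\Sigma^\perp$. This recovers the normal connection: $D_XN$ is the only normal vector $V$ such that $\eta(\mathcal B_N(\tilde N),X)=-\eta(V,\tilde N)$ for all $\tilde N\in T\Sigma^\perp$. -/

import Mathlib

open scoped Manifold ContDiff Topology

noncomputable section

namespace BracketGeometry

/-! Manifolds of dimension `d` are smooth manifolds without boundary, modelled on `ℝ^d`.  `M` is the
ambient manifold (dimension `m`), `S` the submanifold (dimension `n`), `ι : S → M` the map that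
embeds it.  Indices `i j k l` run over `Fin m`, indices `a b` over `Fin n`. -/

/-- The model space `ℝ^d`. -/
abbrev Model (d : ℕ) : Type := EuclideanSpace ℝ (Fin d)

/-- A smooth pseudo-Riemannian metric on a manifold: a smooth family of symmetric nondegenerate
bilinear forms, of arbitrary signature, on the tangent spaces. -/
structure PseudoRiemannianMetric (d : ℕ) (M : Type*) [TopologicalSpace M]
    [ChartedSpace (Model d) M] [IsManifold (𝓡 d) ∞ M] where
  /-- The bilinear form on the tangent space at `q`. -/
  val (q : M) : TangentSpace (𝓡 d) q →L[ℝ] TangentSpace (𝓡 d) q →L[ℝ] ℝ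
  symm (q : M) (v w : TangentSpace (𝓡 d) q) : val q v w = val q w v
  nondegenerate (q : M) (v : TangentSpace (𝓡 d) q) (h : ∀ w, val q v w = 0) : v = 0
  contMDiff : ContMDiff (𝓡 d) ((𝓡 d).prod 𝓘(ℝ, Model d →L[ℝ] Model d →L[ℝ] ℝ)) ∞
    (fun q ↦ Bundle.TotalSpace.mk' (Model d →L[ℝ] Model d →L[ℝ] ℝ)
      (E := fun q : M ↦ TangentSpace (𝓡 d) q →L[ℝ] TangentSpace (𝓡 d) q →L[ℝ] ℝ) q (val q))

section Coordinates

variable {d : ℕ} {M : Type*} [TopologicalSpace M] [ChartedSpace (Model d) M]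

/-- The smooth local coordinate systems of a manifold. -/
abbrev IsCoordinateSystem (φ : OpenPartialHomeomorph M (Model d)) : Prop :=
  φ ∈ IsManifold.maximalAtlas (𝓡 d) ∞ M

/-- The derivative `v(f)` of a function in the direction of a tangent vector `v` at `q`. -/
def dirDeriv (f : M → ℝ) (q : M) (v : TangentSpace (𝓡 d) q) : ℝ := mvfderiv (𝓡 d) f q v

/-- The coordinate vector `∂_i` at `q`. -/
def coordVec (φ : OpenPartialHomeomorph M (Model d)) (q : M) (i : Fin d) :
    TangentSpace (𝓡 d) q :=
  (mfderiv (𝓡 d) 𝓘(ℝ, Model d) φ q).inverse (EuclideanSpace.single i (1 : ℝ))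

/-- The component `v^i` of a tangent vector `v = v^i ∂_i` at `q`, that is `v(x^i)`. -/
def comp (φ : OpenPartialHomeomorph M (Model d)) (q : M) (v : TangentSpace (𝓡 d) q)
    (i : Fin d) : ℝ :=
  dirDeriv (fun q' ↦ φ q' i) q v

variable [IsManifold (𝓡 d) ∞ M]

/-- The matrix `η_{ij}` of the metric at `q` in local coordinates. -/
def metricMatrix (η : PseudoRiemannianMetric d M) (φ : OpenPartialHomeomorph M (Model d)) (q : M) :
    Matrix (Fin d) (Fin d) ℝ :=
  Matrix.of fun i j ↦ η.val q (coordVec φ q i) (coordVec φ q j)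

/-- The Christoffel symbols of the Levi-Civita connection,
`Γ^i_{jk} = (1/2) η^{il} (∂_j η_{lk} + ∂_k η_{jl} - ∂_l η_{jk})`. -/
def christoffel (η : PseudoRiemannianMetric d M) (φ : OpenPartialHomeomorph M (Model d)) (q : M)
    (i j k : Fin d) : ℝ :=
  (1 / 2) * ∑ l, (metricMatrix η φ q)⁻¹ i l *
    (dirDeriv (fun q' ↦ metricMatrix η φ q' l k) q (coordVec φ q j)
      + dirDeriv (fun q' ↦ metricMatrix η φ q' j l) q (coordVec φ q k)
      - dirDeriv (fun q' ↦ metricMatrix η φ q' j k) q (coordVec φ q l))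

end Coordinates

section Submanifold

variable {m : ℕ}
  {M : Type*} [TopologicalSpace M] [ChartedSpace (Model m) M] [IsManifold (𝓡 m) ∞ M]
  {S : Type*} [TopologicalSpace S]

section

variable {n : ℕ} [ChartedSpace (Model n) S]

/-- The push-forward `dι : T_pΣ → T_{ι(p)}M`, through which `T_pΣ` is seen in `T_{ι(p)}M`. -/
def push (ι : S → M) (p : S) : TangentSpace (𝓡 n) p →L[ℝ] TangentSpace (𝓡 m) (ι p) :=
  mfderiv (𝓡 n) (𝓡 m) ι p

end

/-- `ι : S → M` is a pseudo-Riemannian (immersed) submanifold: `ι` is smooth, its differential is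
injective, and the induced metric `g(X, Y) = η(dι X, dι Y)` is nondegenerate. -/
structure IsPseudoRiemannianSubmanifold (n : ℕ) [ChartedSpace (Model n) S]
    (η : PseudoRiemannianMetric m M) (ι : S → M) : Prop where
  contMDiff : ContMDiff (𝓡 n) (𝓡 m) ∞ ι
  injective (p : S) : Function.Injective (push (m := m) (n := n) ι p)
  nondegenerate (p : S) (X : TangentSpace (𝓡 n) p)
    (h : ∀ Y : TangentSpace (𝓡 n) p, η.val (ι p) (push ι p X) (push ι p Y) = 0) : X = 0

/-- The tangent space `T_pΣ` as a subspace of `T_{ι(p)}M`. -/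
def tangentSub (n : ℕ) [ChartedSpace (Model n) S] (ι : S → M) (p : S) :
    Submodule ℝ (TangentSpace (𝓡 m) (ι p)) :=
  LinearMap.range (push (m := m) (n := n) ι p).toLinearMap

/-- The normal space `T_pΣ^⊥`, the vectors of `T_{ι(p)}M` that are `η`-orthogonal to `T_pΣ`. -/
def normalSub (n : ℕ) [ChartedSpace (Model n) S]
    (η : PseudoRiemannianMetric m M) (ι : S → M) (p : S) :
    Submodule ℝ (TangentSpace (𝓡 m) (ι p)) where
  carrier := {v | ∀ X : TangentSpace (𝓡 n) p, η.val (ι p) v (push ι p X) = 0}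
  add_mem' hv hw X := by simp [hv X, hw X]
  zero_mem' X := by simp
  smul_mem' c v hv X := by simp [hv X]

section

variable {n : ℕ} [ChartedSpace (Model n) S]

theorem isCompl_tangentSub_normalSub {η : PseudoRiemannianMetric m M} {ι : S → M}
    (h : IsPseudoRiemannianSubmanifold n η ι) (p : S) :
    IsCompl (tangentSub n ι p) (normalSub n η ι p) := by
  have : FiniteDimensional ℝ (TangentSpace (𝓡 n) p) :=
    inferInstanceAs (FiniteDimensional ℝ (Model n))
  let G : TangentSpace (𝓡 n) p →ₗ[ℝ] Module.Dual ℝ (TangentSpace (𝓡 n) p) :=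
    LinearMap.mk₂ ℝ (fun X Y ↦ η.val (ι p) (push ι p X) (push ι p Y))
      (by simp) (by simp) (by simp) (by simp)
  have hG : Function.Injective G := by
    rw [injective_iff_map_eq_zero]
    intro X hX
    exact h.nondegenerate p X fun Y ↦ congrArg (fun T ↦ T Y) hX
  have hG' : Function.Surjective G :=
    (LinearMap.injective_iff_surjective_of_finrank_eq_finrank
      (Subspace.dual_finrank_eq (K := ℝ)).symm).1 hG
  refine IsCompl.of_eq ?_ ?_
  · rw [eq_bot_iff]
    rintro v ⟨⟨X, rfl⟩, hv⟩
    have : X = 0 := h.nondegenerate p X hv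
    simp [this]
  · rw [eq_top_iff]
    intro v _
    obtain ⟨X, hX⟩ := hG' ((η.val (ι p) v).toLinearMap ∘ₗ (push ι p).toLinearMap)
    refine Submodule.mem_sup.2 ⟨push ι p X, ⟨X, rfl⟩, v - push ι p X, fun Y ↦ ?_, by simp⟩
    have : η.val (ι p) (push ι p X) (push ι p Y) = η.val (ι p) v (push ι p Y) :=
      congrArg (fun T ↦ T Y) hX
    simp [this]

end

/-- A smooth normal vector field along the submanifold, `N_p ∈ T_pΣ^⊥ ⊆ T_{ι(p)}M`. -/
structure IsSmoothNormalField (n : ℕ) [ChartedSpace (Model n) S]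
    (η : PseudoRiemannianMetric m M) (ι : S → M)
    (N : ∀ p : S, TangentSpace (𝓡 m) (ι p)) : Prop where
  contMDiff : ContMDiff (𝓡 n) (𝓡 m).tangent ∞
    (fun p ↦ (⟨ι p, N p⟩ : TangentBundle (𝓡 m) M))
  normal (p : S) : N p ∈ normalSub n η ι p

variable {n : ℕ} [ChartedSpace (Model n) S]

/-- The coordinate function `x^i` of `M`, restricted to the submanifold. -/
def coordFun (ι : S → M) (φ : OpenPartialHomeomorph M (Model m)) (i : Fin m) : S → ℝ :=
  fun p ↦ φ (ι p) i

/-- The component functions `N^j` of a vector field `N = N^j ∂_j` along the submanifold. -/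
def fieldComp (ι : S → M) (φ : OpenPartialHomeomorph M (Model m))
    (N : ∀ p : S, TangentSpace (𝓡 m) (ι p)) (j : Fin m) : S → ℝ :=
  fun p ↦ comp φ (ι p) (N p) j

/-- The Levi-Civita derivative `∇̄_X N` of a vector field along the submanifold in the direction of
`X ∈ T_pΣ`, in local coordinates: `(∇̄_X N)^i = X(N^i) + Γ̄^i_{kl} X(x^k) N^l`. -/
def covDeriv (η : PseudoRiemannianMetric m M) (ι : S → M) (φ : OpenPartialHomeomorph M (Model m))
    (N : ∀ p : S, TangentSpace (𝓡 m) (ι p)) (p : S) (X : TangentSpace (𝓡 n) p) :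
    TangentSpace (𝓡 m) (ι p) :=
  ∑ i, (dirDeriv (fieldComp ι φ N i) p X
    + ∑ k, ∑ l, christoffel η φ (ι p) i k l * dirDeriv (coordFun ι φ k) p X
        * fieldComp ι φ N l p) • coordVec φ (ι p) i

/-- The Weingarten map: `-W_N(X)` is the component of `∇̄_X N` tangent to the submanifold, in the
decomposition `T_{ι(p)}M = T_pΣ ⊕ T_pΣ^⊥`. -/
def weingarten {η : PseudoRiemannianMetric m M} {ι : S → M}
    (h : IsPseudoRiemannianSubmanifold n η ι) (φ : OpenPartialHomeomorph M (Model m))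
    (N : ∀ p : S, TangentSpace (𝓡 m) (ι p)) (p : S) (X : TangentSpace (𝓡 n) p) :
    TangentSpace (𝓡 m) (ι p) :=
  -((tangentSub n ι p).projectionOnto (normalSub n η ι p) (isCompl_tangentSub_normalSub h p)
      (covDeriv η ι φ N p X) : TangentSpace (𝓡 m) (ι p))

/-- The normal connection: `D_X N` is the component of `∇̄_X N` normal to the submanifold. -/
def normalConnection {η : PseudoRiemannianMetric m M} {ι : S → M}
    (h : IsPseudoRiemannianSubmanifold n η ι) (φ : OpenPartialHomeomorph M (Model m))
    (N : ∀ p : S, TangentSpace (𝓡 m) (ι p)) (p : S) (X : TangentSpace (𝓡 n) p) :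
    TangentSpace (𝓡 m) (ι p) :=
  ((normalSub n η ι p).projectionOnto (tangentSub n ι p) (isCompl_tangentSub_normalSub h p).symm
      (covDeriv η ι φ N p X) : TangentSpace (𝓡 m) (ι p))

/-- The matrix `g_{ab} = η(e_a, e_b)` of the induced metric, where `e_a = dι(∂_a)` and `∂_a` are
the coordinate vectors of local coordinates on the submanifold. -/
def inducedMatrix (η : PseudoRiemannianMetric m M) (ι : S → M)
    (ψ : OpenPartialHomeomorph S (Model n)) (p : S) : Matrix (Fin n) (Fin n) ℝ :=
  Matrix.of fun a b ↦ η.val (ι p) (push ι p (coordVec ψ p a)) (push ι p (coordVec ψ p b))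

/-- The derivation `𝒟^i(f) = g^{ab} (∂_a x^i) (∂_b f)` at `p`, for functions `f` on the
submanifold. -/
def projDeriv (η : PseudoRiemannianMetric m M) (ι : S → M) (φ : OpenPartialHomeomorph M (Model m))
    (ψ : OpenPartialHomeomorph S (Model n)) (p : S) (i : Fin m) (f : S → ℝ) : ℝ :=
  ∑ a, ∑ b, (inducedMatrix η ι ψ p)⁻¹ a b
    * dirDeriv (coordFun ι φ i) p (coordVec ψ p a) * dirDeriv f p (coordVec ψ p b)

/-- `𝒟^{ij} = g^{ab} (∂_a x^i) (∂_b x^j)`, the orthogonal projection onto the tangent space with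
the second index raised. -/
def projTensor (η : PseudoRiemannianMetric m M) (ι : S → M) (φ : OpenPartialHomeomorph M (Model m))
    (ψ : OpenPartialHomeomorph S (Model n)) (p : S) (i j : Fin m) : ℝ :=
  projDeriv η ι φ ψ p i (coordFun ι φ j)

/-- `∇̂^i N^j = 𝒟^i(N^j) + 𝒟^{ik} Γ̄^j_{kl} N^l`, the components of `∇̂_Y N = ∇̄_{𝒟(Y)} N`. -/
def nablaHat (η : PseudoRiemannianMetric m M) (ι : S → M) (φ : OpenPartialHomeomorph M (Model m))
    (ψ : OpenPartialHomeomorph S (Model n)) (N : ∀ p : S, TangentSpace (𝓡 m) (ι p)) (p : S)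
    (i j : Fin m) : ℝ :=
  projDeriv η ι φ ψ p i (fieldComp ι φ N j)
    + ∑ k, ∑ l, projTensor η ι φ ψ p i k * christoffel η φ (ι p) j k l * fieldComp ι φ N l p

/-- `ℬ_N^{ij} = -∇̂^i N^j`. -/
def bTensor (η : PseudoRiemannianMetric m M) (ι : S → M) (φ : OpenPartialHomeomorph M (Model m))
    (ψ : OpenPartialHomeomorph S (Model n)) (N : ∀ p : S, TangentSpace (𝓡 m) (ι p)) (p : S)
    (i j : Fin m) : ℝ :=
  -nablaHat η ι φ ψ N p i j

/-- The map `ℬ_N : TM → TM`, `ℬ_N(Y) = ℬ_N^{ij} η_{jk} Y^k ∂_i`. -/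
def bMap (η : PseudoRiemannianMetric m M) (ι : S → M) (φ : OpenPartialHomeomorph M (Model m))
    (ψ : OpenPartialHomeomorph S (Model n)) (N : ∀ p : S, TangentSpace (𝓡 m) (ι p)) (p : S)
    (Y : TangentSpace (𝓡 m) (ι p)) : TangentSpace (𝓡 m) (ι p) :=
  ∑ i, (∑ j, ∑ k, bTensor η ι φ ψ N p i j * metricMatrix η φ (ι p) j k * comp φ (ι p) Y k)
    • coordVec φ (ι p) i

end Submanifold

section Brackets

variable {n : ℕ} {S : Type*} [TopologicalSpace S] [ChartedSpace (Model n) S]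

/-- An `(r+1)`-bracket on `C^∞(Σ)`: a multilinear map that is a derivation in each argument.  No
antisymmetry is assumed. -/
structure Bracket (n : ℕ) (S : Type*) [TopologicalSpace S] [ChartedSpace (Model n) S]
    (r : ℕ) where
  /-- The bracket itself. -/
  toFun : MultilinearMap ℝ (fun _ : Fin (r + 1) ↦ C^∞⟮𝓡 n, S; ℝ⟯) C^∞⟮𝓡 n, S; ℝ⟯
  leibniz (f : Fin (r + 1) → C^∞⟮𝓡 n, S; ℝ⟯) (k : Fin (r + 1)) (u v : C^∞⟮𝓡 n, S; ℝ⟯) :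
    toFun (Function.update f k (u * v)) =
      u * toFun (Function.update f k v) + v * toFun (Function.update f k u)

open Classical in
/-- A globally defined smooth function with the same germ at `p` as `f` (zero if there is none). -/
def germExtension (p : S) (f : S → ℝ) : C^∞⟮𝓡 n, S; ℝ⟯ :=
  if h : ∃ F : C^∞⟮𝓡 n, S; ℝ⟯, (F : S → ℝ) =ᶠ[𝓝 p] f then h.choose else 0

/-- The value `{f_0, …, f_r}(p)` for functions that are smooth near `p`, such as local coordinates.
By the Leibniz rule the bracket is a local operator, so that any globally defined functions with
the same germs at `p` may be inserted. -/
def Bracket.valueAt {r : ℕ} (β : Bracket n S r) (p : S) (f : Fin (r + 1) → S → ℝ) : ℝ :=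
  β.toFun (fun k ↦ germExtension p (f k)) p

variable {m : ℕ} {M : Type*} [TopologicalSpace M] [ChartedSpace (Model m) M]

/-- `{f, x^I}(p) = {f, x^{i_1}, …, x^{i_r}}(p)` for a multi-index `I`. -/
def Bracket.withCoords {r : ℕ} (β : Bracket n S r) (ι : S → M)
    (φ : OpenPartialHomeomorph M (Model m)) (p : S) (f : S → ℝ) (I : Fin r → Fin m) : ℝ :=
  β.valueAt p (Fin.cons f fun k ↦ coordFun ι φ (I k))

/-- `𝒫^{iI} = (1/√(r!)) {x^i, x^I}`. -/
def Bracket.P {r : ℕ} (β : Bracket n S r) (ι : S → M) (φ : OpenPartialHomeomorph M (Model m))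
    (p : S) (i : Fin m) (I : Fin r → Fin m) : ℝ :=
  1 / √(r.factorial : ℝ) * β.withCoords ι φ p (coordFun ι φ i) I

variable [IsManifold (𝓡 m) ∞ M]

/-- `η_{IJ} = η_{i_1 j_1} ⋯ η_{i_r j_r}`. -/
def multiMetric (η : PseudoRiemannianMetric m M) (φ : OpenPartialHomeomorph M (Model m)) (q : M)
    {r : ℕ} (I J : Fin r → Fin m) : ℝ :=
  ∏ k, metricMatrix η φ q (I k) (J k)

/-- A bracket is compatible with the induced metric, with factor `γ` and sign `ε`, if `γ > 0`,
`ε ∈ {-1, 1}` and `𝒫^{iI} 𝒫^{jJ} η_{IJ} = ε γ² g^{ab} (∂_a x^i) (∂_b x^j)` in local coordinates. -/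
structure Bracket.IsCompatible {r : ℕ} (β : Bracket n S r) (η : PseudoRiemannianMetric m M)
    (ι : S → M) (γ : C^∞⟮𝓡 n, S; ℝ⟯) (ε : ℝ) : Prop where
  pos (p : S) : 0 < γ p
  sign : ε = -1 ∨ ε = 1
  relation (φ : OpenPartialHomeomorph M (Model m)) (_ : IsCoordinateSystem φ)
    (ψ : OpenPartialHomeomorph S (Model n)) (_ : IsCoordinateSystem ψ)
    (p : S) (_ : ι p ∈ φ.source) (_ : p ∈ ψ.source) (i j : Fin m) :
    ∑ I : Fin r → Fin m, ∑ J : Fin r → Fin m,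
        β.P ι φ p i I * β.P ι φ p j J * multiMetric η φ (ι p) I J
      = ε * γ p ^ 2 * projTensor η ι φ ψ p i j

end Brackets

end BracketGeometry

end

/-! Everything about `ℬ_N` follows from the factorisation `∇̂^i N^j = g^{ab} e_a^i (∇̄_b N)^j`,
which gives `ℬ_N(Y) = -g^{ab} η(∇̄_b N, Y) e_a`. This vector is visibly tangent, and pairing it with
a tangent `X` cancels `g^{ab}`: `η(ℬ_N(Y), X) = -η(∇̄_X N, Y)` for every ambient `Y`
(`metric_bMap_push`). For normal `Y` only the part `D_X N` of `∇̄_X N` contributes, and `η` is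
nondegenerate on the normal space, so the relation characterises `D_X N`.

For tangent `Y` one also needs the symmetry `η(∇̄_X N, Y) = η(∇̄_Y N, X)`, that is, the symmetry of
the second fundamental form. Differentiating `η(N, e_a) = 0` and inserting the Christoffel symbols
expresses `η(∇̄_b N, e_a)` through terms symmetric in `a` and `b` (`levi_civita_contraction`,
`dirDeriv_normal`). Then `∇̄_X N + ℬ_N(X)` is normal, which identifies `ℬ_N(X)` with `W_N(X)`.

For the bracket formula, `f ↦ {f, x^J}(p)` is a derivation at `p`, hence a tangent vector of `Σ` by
Hadamard's lemma (`IsDerivationAt.exists_eq_sum`). So `𝒟^i` and its bracket expression are both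
tangent vectors at `p`. The compatibility relation says that they agree on the functions `x^j`, and
these separate tangent vectors because `ι` is an immersion. They therefore agree on every function
smooth near `p`, in particular on `N^j` (`projDeriv_eq_bracket`). -/

open scoped Manifold ContDiff Topology

noncomputable section

namespace BracketGeometry

/-! ### Directional derivatives and coordinate frames -/

section Coordinates

variable {d : ℕ} {M : Type*} [TopologicalSpace M] [ChartedSpace (Model d) M]

theorem dirDeriv_add_vec (f : M → ℝ) (q : M) (v w : TangentSpace (𝓡 d) q) :
    dirDeriv f q (v + w) = dirDeriv f q v + dirDeriv f q w :=
  map_add (mvfderiv (𝓡 d) f q) v w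

theorem dirDeriv_smul_vec (f : M → ℝ) (q : M) (c : ℝ) (v : TangentSpace (𝓡 d) q) :
    dirDeriv f q (c • v) = c * dirDeriv f q v :=
  map_smul (mvfderiv (𝓡 d) f q) c v

theorem dirDeriv_sum_vec {ι : Type*} (s : Finset ι) (f : M → ℝ) (q : M)
    (v : ι → TangentSpace (𝓡 d) q) :
    dirDeriv f q (∑ i ∈ s, v i) = ∑ i ∈ s, dirDeriv f q (v i) :=
  map_sum (mvfderiv (𝓡 d) f q) v s

theorem dirDeriv_mul {f g : M → ℝ} {q : M} (hf : MDifferentiableAt (𝓡 d) 𝓘(ℝ, ℝ) f q)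
    (hg : MDifferentiableAt (𝓡 d) 𝓘(ℝ, ℝ) g q) (v : TangentSpace (𝓡 d) q) :
    dirDeriv (fun x ↦ f x * g x) q v = f q * dirDeriv g q v + g q * dirDeriv f q v := by
  simp [dirDeriv, mvfderiv_fun_mul hf hg]

theorem dirDeriv_const (c : ℝ) (q : M) (v : TangentSpace (𝓡 d) q) :
    dirDeriv (fun _ : M ↦ c) q v = 0 := by
  simp [dirDeriv, mvfderiv_const]

theorem dirDeriv_congr {f g : M → ℝ} {q : M} (h : f =ᶠ[𝓝 q] g) (v : TangentSpace (𝓡 d) q) :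
    dirDeriv f q v = dirDeriv g q v := by
  have h2 := h.eq_of_nhds
  have := h.mfderiv_eq (I := 𝓡 d) (I' := 𝓘(ℝ, ℝ))
  unfold dirDeriv mvfderiv
  simp only [ContinuousLinearMap.comp_apply]
  rw [this]
  rfl

theorem mdifferentiableAt_finset_sum {ι : Type*} (s : Finset ι) {f : ι → M → ℝ} {q : M}
    (hf : ∀ i ∈ s, MDifferentiableAt (𝓡 d) 𝓘(ℝ, ℝ) (f i) q) :
    MDifferentiableAt (𝓡 d) 𝓘(ℝ, ℝ) (fun x ↦ ∑ i ∈ s, f i x) q := by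
  classical
  induction s using Finset.induction_on with
  | empty => simpa using mdifferentiableAt_const
  | insert a s ha ih =>
    simp only [Finset.sum_insert ha]
    exact (hf a (by simp)).add (ih fun i hi ↦ hf i (by simp [hi]))

theorem dirDeriv_sum {ι : Type*} (s : Finset ι) {f : ι → M → ℝ} {q : M}
    (hf : ∀ i ∈ s, MDifferentiableAt (𝓡 d) 𝓘(ℝ, ℝ) (f i) q) (v : TangentSpace (𝓡 d) q) :
    dirDeriv (fun x ↦ ∑ i ∈ s, f i x) q v = ∑ i ∈ s, dirDeriv (f i) q v := by
  classical
  induction s using Finset.induction_on with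
  | empty => simpa using dirDeriv_const 0 q v
  | insert a s ha ih =>
    simp only [Finset.sum_insert ha]
    rw [← ih fun i hi ↦ hf i (by simp [hi])]
    have := mvfderiv_fun_add (hf a (by simp))
      (mdifferentiableAt_finset_sum s fun i hi ↦ hf i (by simp [hi]))
    simp [dirDeriv, this]

variable {φ : OpenPartialHomeomorph M (Model d)} {q : M}

theorem IsCoordinateSystem.contMDiffAt (hφ : IsCoordinateSystem φ) (hq : q ∈ φ.source) :
    ContMDiffAt (𝓡 d) 𝓘(ℝ, Model d) ∞ φ q :=
  contMDiffAt_of_mem_maximalAtlas hφ hq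

theorem IsCoordinateSystem.contMDiffAt_symm (hφ : IsCoordinateSystem φ) {x : Model d}
    (hx : x ∈ φ.target) : ContMDiffAt 𝓘(ℝ, Model d) (𝓡 d) ∞ φ.symm x :=
  contMDiffAt_symm_of_mem_maximalAtlas hφ hx

theorem IsCoordinateSystem.mdifferentiable (hφ : IsCoordinateSystem φ) :
    φ.MDifferentiable (𝓡 d) 𝓘(ℝ, Model d) :=
  ⟨fun _ hx ↦ ((hφ.contMDiffAt hx).mdifferentiableAt (by simp)).mdifferentiableWithinAt,
    fun _ hx ↦ ((hφ.contMDiffAt_symm hx).mdifferentiableAt (by simp)).mdifferentiableWithinAt⟩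

theorem coordVec_eq (hφ : IsCoordinateSystem φ) (hq : q ∈ φ.source) (i : Fin d) :
    mfderiv (𝓡 d) 𝓘(ℝ, Model d) φ q (coordVec φ q i) = EuclideanSpace.single i (1 : ℝ) := by
  have h : (mfderiv (𝓡 d) 𝓘(ℝ, Model d) φ q).IsInvertible :=
    ⟨hφ.mdifferentiable.mfderiv hq, rfl⟩
  exact h.self_apply_inverse _

theorem coordVec_eq_symm (hφ : IsCoordinateSystem φ) (hq : q ∈ φ.source) (i : Fin d) :
    coordVec φ q i = (mfderiv 𝓘(ℝ, Model d) (𝓡 d) φ.symm (φ q) (EuclideanSpace.single i (1 : ℝ)) :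
      TangentSpace (𝓡 d) (φ.symm (φ q))) := by
  have h := hφ.mdifferentiable.symm_comp_deriv hq
  have h2 := congrArg (fun T ↦ T (coordVec φ q i)) h
  simp only [ContinuousLinearMap.comp_apply] at h2
  rw [coordVec_eq hφ hq] at h2
  exact h2.symm

theorem comp_eq (hφ : IsCoordinateSystem φ) (hq : q ∈ φ.source) (v : TangentSpace (𝓡 d) q)
    (i : Fin d) : comp φ q v i = (show Model d from mfderiv (𝓡 d) 𝓘(ℝ, Model d) φ q v) i := by
  have h := mfderiv_comp q (g := fun x : Model d ↦ x i) (I'' := 𝓘(ℝ, ℝ))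
    ((EuclideanSpace.proj i : Model d →L[ℝ] ℝ).differentiableAt.mdifferentiableAt)
    (hφ.mdifferentiable.mdifferentiableAt hq)
  have h3 : mfderiv 𝓘(ℝ, Model d) 𝓘(ℝ, ℝ) (fun x : Model d ↦ x i) (φ q) =
      (EuclideanSpace.proj i : Model d →L[ℝ] ℝ) := by
    rw [mfderiv_eq_fderiv]
    exact (EuclideanSpace.proj i : Model d →L[ℝ] ℝ).fderiv
  have h4 := congrArg (fun T ↦ T v) h
  rw [h3] at h4
  exact h4

theorem comp_smul (c : ℝ) (v : TangentSpace (𝓡 d) q) (i : Fin d) :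
    comp φ q (c • v) i = c * comp φ q v i := dirDeriv_smul_vec _ _ _ _

theorem comp_sum {ι : Type*} (s : Finset ι) (v : ι → TangentSpace (𝓡 d) q) (i : Fin d) :
    comp φ q (∑ j ∈ s, v j) i = ∑ j ∈ s, comp φ q (v j) i := dirDeriv_sum_vec _ _ _ _

theorem comp_coordVec (hφ : IsCoordinateSystem φ) (hq : q ∈ φ.source) (i j : Fin d) :
    comp φ q (coordVec φ q i) j = if j = i then 1 else 0 := by
  rw [comp_eq hφ hq, coordVec_eq hφ hq]
  simp

theorem comp_ext (hφ : IsCoordinateSystem φ) (hq : q ∈ φ.source) {v w : TangentSpace (𝓡 d) q}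
    (h : ∀ i, comp φ q v i = comp φ q w i) : v = w := by
  apply hφ.mdifferentiable.mfderiv_injective hq
  apply WithLp.ofLp_injective
  funext i
  have := h i
  rwa [comp_eq hφ hq, comp_eq hφ hq] at this

theorem comp_sum_coordVec (hφ : IsCoordinateSystem φ) (hq : q ∈ φ.source) (c : Fin d → ℝ)
    (j : Fin d) : comp φ q (∑ i, c i • coordVec φ q i) j = c j := by
  simp [comp_sum, comp_smul, comp_coordVec hφ hq]

theorem sum_comp_smul (hφ : IsCoordinateSystem φ) (hq : q ∈ φ.source)
    (v : TangentSpace (𝓡 d) q) : ∑ i, comp φ q v i • coordVec φ q i = v :=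
  comp_ext hφ hq fun j ↦ comp_sum_coordVec hφ hq _ j

theorem dirDeriv_eq_sum (hφ : IsCoordinateSystem φ) (hq : q ∈ φ.source) (f : M → ℝ)
    (v : TangentSpace (𝓡 d) q) :
    dirDeriv f q v = ∑ i, comp φ q v i * dirDeriv f q (coordVec φ q i) := by
  conv_lhs => rw [← sum_comp_smul hφ hq v]
  simp [dirDeriv_sum_vec, dirDeriv_smul_vec]

/-- The bridge to calculus on `ℝ^d`: symmetry of second derivatives and Hadamard's lemma are both
transported through it. -/
theorem dirDeriv_coordVec (hφ : IsCoordinateSystem φ) (hq : q ∈ φ.source) {f : M → ℝ}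
    (hf : MDifferentiableAt (𝓡 d) 𝓘(ℝ, ℝ) f q) (i : Fin d) :
    dirDeriv f q (coordVec φ q i) =
      fderiv ℝ (f ∘ φ.symm) (φ q) (EuclideanSpace.single i (1 : ℝ)) := by
  rw [← mfderiv_eq_fderiv, mfderiv_comp_of_eq (I' := 𝓡 d) (y := q) hf
    (hφ.mdifferentiable.mdifferentiableAt_symm (φ.map_source hq)) (φ.left_inv hq)]
  rw [coordVec_eq_symm hφ hq]
  -- `φ.symm (φ q)` equals `q` only propositionally, so the base point is generalised before it is
  -- identified with `q`.
  have aux : ∀ q', q' = q → ∀ v : Model d,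
      dirDeriv f q v = (show ℝ from mfderiv (𝓡 d) 𝓘(ℝ, ℝ) f q' v) := by
    rintro _ rfl v
    rfl
  exact aux _ (φ.left_inv hq) _

theorem contMDiffAt_coord (hφ : IsCoordinateSystem φ) (hq : q ∈ φ.source) (i : Fin d) :
    ContMDiffAt (𝓡 d) 𝓘(ℝ, ℝ) ∞ (fun q' ↦ φ q' i) q :=
  (EuclideanSpace.proj i : Model d →L[ℝ] ℝ).contMDiff.contMDiffAt.comp q
    (hφ.contMDiffAt hq)

end Coordinates

/-! ### Smoothness of frame and metric, lowered Christoffel symbols -/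

section Coordinates

variable {d : ℕ} {M : Type*} [TopologicalSpace M] [ChartedSpace (Model d) M]
  [IsManifold (𝓡 d) ∞ M] {φ : OpenPartialHomeomorph M (Model d)} {q : M}

/-- The frame is the image of a constant vector field on `ℝ^d` under the tangent map of `φ.symm`. -/
theorem contMDiffAt_coordVec (hφ : IsCoordinateSystem φ) (hq : q ∈ φ.source) (i : Fin d) :
    ContMDiffAt (𝓡 d) (𝓡 d).tangent ∞
      (fun q' ↦ (⟨q', coordVec φ q' i⟩ : TangentBundle (𝓡 d) M)) q := by
  have : IsManifold (𝓡 d) 1 M := .of_le (n := ∞) (by simp)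
  have h1 : ContMDiffOn 𝓘(ℝ, Model d) (𝓡 d) ∞ φ.symm φ.target :=
    contMDiffOn_symm_of_mem_maximalAtlas hφ
  have h2 := h1.contMDiffOn_tangentMapWithin (m := ∞) (by simp) φ.open_target.uniqueMDiffOn
  have h3 : ContMDiff 𝓘(ℝ, Model d) 𝓘(ℝ, Model d).tangent ∞
      (fun x ↦ (⟨x, EuclideanSpace.single i (1 : ℝ)⟩ : TangentBundle 𝓘(ℝ, Model d) (Model d))) :=
    contMDiff_vectorSpace_iff_contDiff.2 contDiff_const
  have h4 := (h3.comp_contMDiffOn (contMDiffOn_of_mem_maximalAtlas hφ))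
  have h5 := (h2.comp h4 (fun x hx ↦ φ.map_source hx)).contMDiffAt (φ.open_source.mem_nhds hq)
  refine h5.congr_of_eventuallyEq ?_
  filter_upwards [φ.open_source.mem_nhds hq] with q' hq'
  simp only [Function.comp, tangentMapWithin]
  rw [mfderivWithin_of_mem_nhds (φ.open_target.mem_nhds (φ.map_source hq'))]
  rw [coordVec_eq_symm hφ hq']
  have : φ.symm (φ q') = q' := φ.left_inv hq'
  congr 1
  exact this.symm

theorem contMDiffAt_metricMatrix (η : PseudoRiemannianMetric d M) (hφ : IsCoordinateSystem φ)
    (hq : q ∈ φ.source) (i j : Fin d) :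
    ContMDiffAt (𝓡 d) 𝓘(ℝ, ℝ) ∞ (fun q' ↦ metricMatrix η φ q' i j) q := by
  have : ContMDiffAt (𝓡 d) ((𝓡 d).prod 𝓘(ℝ)) ∞
      (fun q' ↦ Bundle.TotalSpace.mk' ℝ (E := Bundle.Trivial M ℝ) q'
        (η.val q' (coordVec φ q' i) (coordVec φ q' j))) q :=
    ContMDiffAt.clm_bundle_apply₂ (F₁ := Model d) (F₂ := Model d) (η.contMDiff q)
      (contMDiffAt_coordVec hφ hq i) (contMDiffAt_coordVec hφ hq j)
  simp only [Bundle.contMDiffAt_totalSpace] at this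
  exact this.2

/-- The component is the fibre part of the tangent map of the coordinate function `x^i`, hence
smooth on the tangent bundle over the chart. -/
theorem contMDiffOn_comp (hφ : IsCoordinateSystem φ) (i : Fin d) :
    ContMDiffOn (𝓡 d).tangent 𝓘(ℝ, ℝ) ∞ (fun v : TangentBundle (𝓡 d) M ↦ comp φ v.1 v.2 i)
      (Bundle.TotalSpace.proj ⁻¹' φ.source) := by
  have : IsManifold (𝓡 d) 1 M := .of_le (n := ∞) (by simp)
  have h1 : ContMDiffOn (𝓡 d) 𝓘(ℝ, ℝ) ∞ (fun q' ↦ φ q' i) φ.source :=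
    fun q' hq' ↦ (contMDiffAt_coord hφ hq' i).contMDiffWithinAt
  have h2 := h1.contMDiffOn_tangentMapWithin (m := ∞) (by simp) φ.open_source.uniqueMDiffOn
  have h3 := (contMDiff_snd_tangentBundle_modelSpace ℝ 𝓘(ℝ, ℝ) (n := ∞)).comp_contMDiffOn h2
  refine h3.congr fun v hv ↦ ?_
  simp only [Function.comp, tangentMapWithin]
  rw [mfderivWithin_of_mem_nhds (φ.open_source.mem_nhds hv)]
  rfl

theorem metric_eq_sum (η : PseudoRiemannianMetric d M) (hφ : IsCoordinateSystem φ)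
    (hq : q ∈ φ.source) (v w : TangentSpace (𝓡 d) q) :
    η.val q v w = ∑ i, ∑ j, comp φ q v i * metricMatrix η φ q i j * comp φ q w j := by
  conv_lhs => rw [← sum_comp_smul hφ hq v, ← sum_comp_smul hφ hq w]
  simp only [map_sum, map_smul, sum_apply, smul_apply,
    smul_eq_mul, metricMatrix, Matrix.of_apply, Finset.mul_sum]
  rw [Finset.sum_comm]
  exact Finset.sum_congr rfl fun i _ ↦ Finset.sum_congr rfl fun j _ ↦ by ring

theorem metricMatrix_symm (η : PseudoRiemannianMetric d M) (φ : OpenPartialHomeomorph M (Model d))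
    (q : M) (i j : Fin d) : metricMatrix η φ q i j = metricMatrix η φ q j i :=
  η.symm q _ _

theorem isUnit_det_of_nondegenerate {ι : Type*} [Fintype ι] [DecidableEq ι] {A : Matrix ι ι ℝ}
    (h : ∀ c : ι → ℝ, (∀ j, ∑ i, c i * A i j = 0) → c = 0) : IsUnit A.det := by
  rw [isUnit_iff_ne_zero]
  intro h0
  obtain ⟨v, hv, hv'⟩ := Matrix.exists_vecMul_eq_zero_iff.2 h0
  exact hv (h v fun j ↦ congrFun hv' j)

theorem isUnit_det_metricMatrix (η : PseudoRiemannianMetric d M) (hφ : IsCoordinateSystem φ)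
    (hq : q ∈ φ.source) : IsUnit (metricMatrix η φ q).det := by
  refine isUnit_det_of_nondegenerate fun c hc ↦ ?_
  have : ∑ i, c i • coordVec φ q i = 0 := by
    refine η.nondegenerate q _ fun w ↦ ?_
    rw [metric_eq_sum η hφ hq, Finset.sum_comm]
    simp only [comp_sum_coordVec hφ hq, ← Finset.sum_mul, hc, zero_mul, Finset.sum_const_zero]
  funext i
  rw [← comp_sum_coordVec hφ hq c i, this]
  exact map_zero (mvfderiv (𝓡 d) _ q)

/-- Lowering the index cancels the inverse metric, so later computations involve only first
derivatives of `η_{ij}`. -/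
theorem sum_metricMatrix_mul_christoffel (η : PseudoRiemannianMetric d M)
    (hφ : IsCoordinateSystem φ) (hq : q ∈ φ.source) (h j k : Fin d) :
    ∑ i, metricMatrix η φ q h i * christoffel η φ q i j k =
      (1 / 2) * (dirDeriv (fun q' ↦ metricMatrix η φ q' h k) q (coordVec φ q j)
      + dirDeriv (fun q' ↦ metricMatrix η φ q' j h) q (coordVec φ q k)
      - dirDeriv (fun q' ↦ metricMatrix η φ q' j k) q (coordVec φ q h)) := by
  set T : Fin d → ℝ := fun l ↦ dirDeriv (fun q' ↦ metricMatrix η φ q' l k) q (coordVec φ q j)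
      + dirDeriv (fun q' ↦ metricMatrix η φ q' j l) q (coordVec φ q k)
      - dirDeriv (fun q' ↦ metricMatrix η φ q' j k) q (coordVec φ q l) with hT
  have h1 : metricMatrix η φ q * (metricMatrix η φ q)⁻¹ = 1 :=
    Matrix.mul_nonsing_inv _ (isUnit_det_metricMatrix η hφ hq)
  calc ∑ i, metricMatrix η φ q h i * christoffel η φ q i j k
      = (1 / 2) * ∑ l, (metricMatrix η φ q * (metricMatrix η φ q)⁻¹) h l * T l := by
        simp only [christoffel, Matrix.mul_apply, Finset.mul_sum, Finset.sum_mul]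
        rw [Finset.sum_comm]
        exact Finset.sum_congr rfl fun i _ ↦ Finset.sum_congr rfl fun l _ ↦ by ring
    _ = (1 / 2) * T h := by simp [h1, Matrix.one_apply]

end Coordinates

/-! ### Functions restricted to the submanifold -/

section Submanifold

variable {m n : ℕ}
  {M : Type*} [TopologicalSpace M] [ChartedSpace (Model m) M]
  {S : Type*} [TopologicalSpace S] [ChartedSpace (Model n) S]
  {ι : S → M} {φ : OpenPartialHomeomorph M (Model m)} {ψ : OpenPartialHomeomorph S (Model n)}
  {p : S}

theorem dirDeriv_comp_eq_push {f : M → ℝ} (hf : MDifferentiableAt (𝓡 m) 𝓘(ℝ, ℝ) f (ι p))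
    (hι : MDifferentiableAt (𝓡 n) (𝓡 m) ι p) (X : TangentSpace (𝓡 n) p) :
    dirDeriv (fun p' ↦ f (ι p')) p X = dirDeriv f (ι p) (push (m := m) ι p X) :=
  congrArg (fun T ↦ T X) (mfderiv_comp p hf hι)

theorem dirDeriv_coordFun (hφ : IsCoordinateSystem φ) (hp : ι p ∈ φ.source)
    (hι : MDifferentiableAt (𝓡 n) (𝓡 m) ι p) (X : TangentSpace (𝓡 n) p) (k : Fin m) :
    dirDeriv (coordFun ι φ k) p X = comp φ (ι p) (push ι p X) k :=
  dirDeriv_comp_eq_push (f := fun q ↦ φ q k)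
    ((contMDiffAt_coord hφ hp k).mdifferentiableAt (by simp)) hι X

theorem contMDiffAt_coordFun (hφ : IsCoordinateSystem φ) (hp : ι p ∈ φ.source)
    (hι : ContMDiffAt (𝓡 n) (𝓡 m) ∞ ι p) (k : Fin m) :
    ContMDiffAt (𝓡 n) 𝓘(ℝ, ℝ) ∞ (coordFun ι φ k) p :=
  (contMDiffAt_coord hφ hp k).comp p hι

theorem contMDiffAt_fieldComp [IsManifold (𝓡 m) ∞ M] (hφ : IsCoordinateSystem φ)
    (hp : ι p ∈ φ.source)
    {N : ∀ p : S, TangentSpace (𝓡 m) (ι p)} (hN : ContMDiffAt (𝓡 n) (𝓡 m).tangent ∞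
      (fun p ↦ (⟨ι p, N p⟩ : TangentBundle (𝓡 m) M)) p) (k : Fin m) :
    ContMDiffAt (𝓡 n) 𝓘(ℝ, ℝ) ∞ (fieldComp ι φ N k) p := by
  have h : ContMDiffAt (𝓡 m).tangent 𝓘(ℝ, ℝ) ∞
      (fun v : TangentBundle (𝓡 m) M ↦ comp φ v.1 v.2 k) ⟨ι p, N p⟩ :=
    (contMDiffOn_comp hφ k).contMDiffAt ((φ.open_source.preimage
      (FiberBundle.continuous_proj (Model m) (TangentSpace (𝓡 m)))).mem_nhds hp)
  exact h.comp p hN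

/-- Second coordinate derivatives are symmetric. -/
theorem dirDeriv_dirDeriv_comm (hψ : IsCoordinateSystem ψ) (hp : p ∈ ψ.source) {f : S → ℝ}
    (hf : ∀ᶠ p' in 𝓝 p, ContMDiffAt (𝓡 n) 𝓘(ℝ, ℝ) ∞ f p') (a b : Fin n) :
    MDifferentiableAt (𝓡 n) 𝓘(ℝ, ℝ) (fun p' ↦ dirDeriv f p' (coordVec ψ p' a)) p ∧
    dirDeriv (fun p' ↦ dirDeriv f p' (coordVec ψ p' a)) p (coordVec ψ p b) =
      dirDeriv (fun p' ↦ dirDeriv f p' (coordVec ψ p' b)) p (coordVec ψ p a) := by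
  have h1 : ContDiffAt ℝ ∞ (f ∘ ψ.symm) (ψ p) := by
    rw [← contMDiffAt_iff_contDiffAt]
    exact ContMDiffAt.comp_of_eq hf.self_of_nhds (hψ.contMDiffAt_symm (ψ.map_source hp))
      (ψ.left_inv hp)
  -- The identification with a partial derivative must hold near `p`, since it is differentiated
  -- once more.
  have h2 : ∀ a : Fin n, (fun p' ↦ dirDeriv f p' (coordVec ψ p' a)) =ᶠ[𝓝 p]
      fun p' ↦ fderiv ℝ (f ∘ ψ.symm) (ψ p') (EuclideanSpace.single a (1 : ℝ)) := by
    intro a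
    filter_upwards [hf, ψ.open_source.mem_nhds hp] with p' hp' hs
    exact dirDeriv_coordVec hψ hs (hp'.mdifferentiableAt (by simp)) a
  have h3 : ContDiffAt ℝ 1 (fderiv ℝ (f ∘ ψ.symm)) (ψ p) := h1.fderiv_right (by norm_cast)
  have h4 : ∀ a : Fin n, MDifferentiableAt (𝓡 n) 𝓘(ℝ, ℝ)
      (fun p' ↦ fderiv ℝ (f ∘ ψ.symm) (ψ p') (EuclideanSpace.single a (1 : ℝ))) p := by
    intro a
    have : DifferentiableAt ℝ
      (fun x ↦ fderiv ℝ (f ∘ ψ.symm) x (EuclideanSpace.single a (1 : ℝ))) (ψ p) :=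
        (h3.differentiableAt (by simp)).clm_apply (differentiableAt_const _)
    exact this.mdifferentiableAt.comp p (hψ.mdifferentiable.mdifferentiableAt hp)
  have h5 : ∀ a b : Fin n,
      dirDeriv (fun p' ↦ dirDeriv f p' (coordVec ψ p' a)) p (coordVec ψ p b) =
        fderiv ℝ (fderiv ℝ (f ∘ ψ.symm)) (ψ p) (EuclideanSpace.single b (1 : ℝ))
          (EuclideanSpace.single a (1 : ℝ)) := by
    intro a b
    rw [dirDeriv_congr (h2 a), dirDeriv_coordVec hψ hp (h4 a)]
    have : (fun p' ↦ fderiv ℝ (f ∘ ψ.symm) (ψ p') (EuclideanSpace.single a (1 : ℝ))) ∘ ψ.symm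
        =ᶠ[𝓝 (ψ p)] fun x ↦ fderiv ℝ (f ∘ ψ.symm) x (EuclideanSpace.single a (1 : ℝ)) := by
      filter_upwards [ψ.open_target.mem_nhds (ψ.map_source hp)] with x hx
      simp [ψ.right_inv hx]
    rw [this.fderiv_eq, fderiv_clm_apply (h3.differentiableAt (by simp))
      (differentiableAt_const _)]
    simp
  refine ⟨(h4 a).congr_of_eventuallyEq (h2 a), ?_⟩
  rw [h5, h5]
  exact (h1.isSymmSndFDerivAt (by simpa using (by norm_cast : ((2 : ℕ) : ℕ∞ω) ≤ ∞))).eq _ _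

end Submanifold

/-! ### The index computation behind the symmetry -/

section Algebra

variable {κ : Type*} [Fintype κ]

/-- Here `A` is `η_{ij}`, `dA k i j` is `∂_k η_{ij}`, `x` and `y` are the components of `e_a` and
`e_b`, `dN` is `∂_b N` and `h` is `∂_b ∂_a x`; `hD` is the derivative of `η(N, e_a) = 0`. Solving
`hD` for the `dN` term cancels half of the Christoffel contribution. What remains has a bracket
symmetric in `j` and `k`, so the result is unchanged when `x` and `y` are exchanged. -/
theorem levi_civita_contraction {A : κ → κ → ℝ} {dA Γ : κ → κ → κ → ℝ} {N x y dN h : κ → ℝ}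
    (hA : ∀ i j, A i j = A j i) (hdA : ∀ k i j, dA k i j = dA k j i)
    (hΓ : ∀ h j k, ∑ i, A h i * Γ i j k = (1 / 2) * (dA j h k + dA k j h - dA h j k))
    (hD : ∑ i, ∑ j, ((N i * A i j) * h j
      + x j * (N i * ∑ k, y k * dA k i j + A i j * dN i)) = 0) :
    ∑ i, ∑ j, (dN i + ∑ k, ∑ l, Γ i k l * y k * N l) * A i j * x j =
      -(∑ i, ∑ j, (N i * A i j) * h j)
        + (1 / 2) * ∑ j, ∑ k, ∑ l, x j * y k * N l * (dA l k j - dA k j l - dA j k l) := by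
  have h1 : ∑ i, ∑ j, (∑ k, ∑ l, Γ i k l * y k * N l) * A i j * x j =
      ∑ j, ∑ k, ∑ l, x j * y k * N l *
        ((1 / 2) * (dA k j l + dA l k j - dA j k l)) := by
    simp only [← hΓ, Finset.sum_mul, Finset.mul_sum]
    rw [Finset.sum_comm]
    refine Finset.sum_congr rfl fun j _ ↦ ?_
    rw [Finset.sum_comm]
    refine Finset.sum_congr rfl fun k _ ↦ ?_
    rw [Finset.sum_comm]
    refine Finset.sum_congr rfl fun l _ ↦ Finset.sum_congr rfl fun i _ ↦ ?_
    rw [hA j i]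
    ring
  have h2 : ∑ i, ∑ j, x j * (N i * ∑ k, y k * dA k i j) =
      ∑ j, ∑ k, ∑ l, x j * y k * N l * dA k j l := by
    simp only [Finset.mul_sum]
    rw [Finset.sum_comm]
    refine Finset.sum_congr rfl fun j _ ↦ ?_
    rw [Finset.sum_comm]
    refine Finset.sum_congr rfl fun k _ ↦ Finset.sum_congr rfl fun l _ ↦ ?_
    rw [hdA k l j]
    ring
  have h3 : ∑ i, ∑ j, (dN i + ∑ k, ∑ l, Γ i k l * y k * N l) * A i j * x j =
      ∑ i, ∑ j, x j * (A i j * dN i)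
        + ∑ i, ∑ j, (∑ k, ∑ l, Γ i k l * y k * N l) * A i j * x j := by
    simp only [← Finset.sum_add_distrib]
    exact Finset.sum_congr rfl fun i _ ↦ Finset.sum_congr rfl fun j _ ↦ by ring
  have h4 : (1 / 2) * ∑ j, ∑ k, ∑ l, x j * y k * N l * (dA l k j - dA k j l - dA j k l) =
      ∑ j, ∑ k, ∑ l, x j * y k * N l * ((1 / 2) * (dA k j l + dA l k j - dA j k l))
        - ∑ j, ∑ k, ∑ l, x j * y k * N l * dA k j l := by
    simp only [Finset.mul_sum, ← Finset.sum_sub_distrib]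
    exact Finset.sum_congr rfl fun i _ ↦ Finset.sum_congr rfl fun j _ ↦
      Finset.sum_congr rfl fun l _ ↦ by ring
  simp only [mul_add (x _), Finset.sum_add_distrib] at hD
  rw [h2] at hD
  rw [h3, h1, h4]
  linarith

end Algebra

/-! ### Symmetry of the second fundamental form -/

section Submanifold

variable {m n : ℕ}
  {M : Type*} [TopologicalSpace M] [ChartedSpace (Model m) M] [IsManifold (𝓡 m) ∞ M]
  {S : Type*} [TopologicalSpace S] [ChartedSpace (Model n) S]
  {η : PseudoRiemannianMetric m M}
  {ι : S → M} {φ : OpenPartialHomeomorph M (Model m)} {ψ : OpenPartialHomeomorph S (Model n)}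
  {N : ∀ p : S, TangentSpace (𝓡 m) (ι p)} {p : S}

theorem IsPseudoRiemannianSubmanifold.mdifferentiableAt
    (hι : IsPseudoRiemannianSubmanifold n η ι) (p : S) : MDifferentiableAt (𝓡 n) (𝓡 m) ι p :=
  (hι.contMDiff p).mdifferentiableAt (by simp)

variable (η ι φ N p) in
/-- The covariant derivative `X ↦ ∇̄_X N` as a linear map. -/
def covDerivLinear : TangentSpace (𝓡 n) p →ₗ[ℝ] TangentSpace (𝓡 m) (ι p) where
  toFun := covDeriv η ι φ N p
  map_add' X Y := by
    simp only [covDeriv, dirDeriv_add_vec, ← Finset.sum_add_distrib, ← add_smul]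
    refine Finset.sum_congr rfl fun i _ ↦ ?_
    simp only [mul_add, add_mul, Finset.sum_add_distrib]
    congr 1
    ring
  map_smul' c X := by
    simp only [covDeriv, dirDeriv_smul_vec, Finset.smul_sum, smul_smul, RingHom.id_apply, mul_add,
      Finset.mul_sum]
    refine Finset.sum_congr rfl fun i _ ↦ ?_
    congr 2
    exact Finset.sum_congr rfl fun k _ ↦ Finset.sum_congr rfl fun l _ ↦ by ring

theorem covDeriv_sum_smul {κ : Type*} (s : Finset κ) (c : κ → ℝ)
    (X : κ → TangentSpace (𝓡 n) p) :
    covDeriv η ι φ N p (∑ a ∈ s, c a • X a) = ∑ a ∈ s, c a • covDeriv η ι φ N p (X a) := by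
  change covDerivLinear η ι φ N p _ = ∑ a ∈ s, c a • covDerivLinear η ι φ N p (X a)
  simp

theorem comp_covDeriv (hφ : IsCoordinateSystem φ) (hp : ι p ∈ φ.source)
    (X : TangentSpace (𝓡 n) p) (i : Fin m) :
    comp φ (ι p) (covDeriv η ι φ N p X) i = dirDeriv (fieldComp ι φ N i) p X
    + ∑ k, ∑ l, christoffel η φ (ι p) i k l * dirDeriv (coordFun ι φ k) p X
        * fieldComp ι φ N l p :=
  comp_sum_coordVec hφ hp _ i

/-- The derivative of the identity `η(N, e_a) = 0`. -/
theorem dirDeriv_normal (hι : IsPseudoRiemannianSubmanifold n η ι)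
    (hN : IsSmoothNormalField n η ι N) (hφ : IsCoordinateSystem φ) (hψ : IsCoordinateSystem ψ)
    (hpφ : ι p ∈ φ.source) (hpψ : p ∈ ψ.source) (a b : Fin n) :
    ∑ i, ∑ j, ((fieldComp ι φ N i p * metricMatrix η φ (ι p) i j)
        * dirDeriv (fun p' ↦ dirDeriv (coordFun ι φ j) p' (coordVec ψ p' a)) p (coordVec ψ p b)
      + dirDeriv (coordFun ι φ j) p (coordVec ψ p a)
        * (fieldComp ι φ N i p * ∑ k, dirDeriv (coordFun ι φ k) p (coordVec ψ p b) *
            dirDeriv (fun q ↦ metricMatrix η φ q i j) (ι p) (coordVec φ (ι p) k)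
          + metricMatrix η φ (ι p) i j * dirDeriv (fieldComp ι φ N i) p (coordVec ψ p b))) = 0 := by
  have hopen : ∀ᶠ p' in 𝓝 p, ι p' ∈ φ.source :=
    hι.contMDiff.continuous.continuousAt.eventually (φ.open_source.mem_nhds hpφ)
  have hx : ∀ j, MDifferentiableAt (𝓡 n) 𝓘(ℝ, ℝ)
      (fun p' ↦ dirDeriv (coordFun ι φ j) p' (coordVec ψ p' a)) p := fun j ↦
    (dirDeriv_dirDeriv_comm hψ hpψ (hopen.mono fun p' hp' ↦
      contMDiffAt_coordFun hφ hp' (hι.contMDiff p') j) a b).1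
  have hη : ∀ i j, MDifferentiableAt (𝓡 m) 𝓘(ℝ, ℝ) (fun q ↦ metricMatrix η φ q i j) (ι p) :=
    fun i j ↦ (contMDiffAt_metricMatrix η hφ hpφ i j).mdifferentiableAt (by simp)
  have hηι : ∀ i j, MDifferentiableAt (𝓡 n) 𝓘(ℝ, ℝ) (fun p' ↦ metricMatrix η φ (ι p') i j) p :=
    fun i j ↦ (hη i j).comp p (hι.mdifferentiableAt p)
  have hNi : ∀ i, MDifferentiableAt (𝓡 n) 𝓘(ℝ, ℝ) (fieldComp ι φ N i) p := fun i ↦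
    (contMDiffAt_fieldComp hφ hpφ (hN.contMDiff p) i).mdifferentiableAt (by simp)
  have hprod : ∀ i j, MDifferentiableAt (𝓡 n) 𝓘(ℝ, ℝ)
      (fun p' ↦ fieldComp ι φ N i p' * metricMatrix η φ (ι p') i j) p := fun i j ↦
    (hNi i).mul (hηι i j)
  have hterm : ∀ i j, MDifferentiableAt (𝓡 n) 𝓘(ℝ, ℝ)
      (fun p' ↦ (fieldComp ι φ N i p' * metricMatrix η φ (ι p') i j) *
        dirDeriv (coordFun ι φ j) p' (coordVec ψ p' a)) p := fun i j ↦
    (hprod i j).mul (hx j)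
  -- Normality of `N`, written in the chart `φ`, is an identity on a neighbourhood of `p` and may be
  -- differentiated.
  have hzero : (fun p' ↦ ∑ i, ∑ j, (fieldComp ι φ N i p' * metricMatrix η φ (ι p') i j) *
      dirDeriv (coordFun ι φ j) p' (coordVec ψ p' a)) =ᶠ[𝓝 p] fun _ ↦ 0 := by
    filter_upwards [hopen] with p' hp'
    rw [← hN.normal p' (coordVec ψ p' a), metric_eq_sum η hφ hp']
    simp only [dirDeriv_coordFun hφ hp' (hι.mdifferentiableAt p')]
    rfl
  have hd := dirDeriv_congr hzero (coordVec ψ p b)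
  rw [dirDeriv_const, dirDeriv_sum _ fun i _ ↦ mdifferentiableAt_finset_sum _ fun j _ ↦
    hterm i j] at hd
  rw [← hd]
  refine Finset.sum_congr rfl fun i _ ↦ ?_
  rw [dirDeriv_sum _ fun j _ ↦ hterm i j]
  refine Finset.sum_congr rfl fun j _ ↦ ?_
  rw [dirDeriv_mul (hprod i j) (hx j), dirDeriv_mul (hNi i) (hηι i j),
    dirDeriv_comp_eq_push (hη i j) (hι.mdifferentiableAt p), dirDeriv_eq_sum hφ hpφ _ (push ι p _)]
  simp only [dirDeriv_coordFun hφ hpφ (hι.mdifferentiableAt p)]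

/-- Morally both sides are `-η(N, ∇̄_b e_a)`, with `∇̄_b e_a = ∇̄_a e_b` by torsion-freeness. In
coordinates this is the symmetry of `∂_a ∂_b x^j` together with that of the metric term in
`levi_civita_contraction`. -/
theorem metric_covDeriv_push_coordVec (hι : IsPseudoRiemannianSubmanifold n η ι)
    (hN : IsSmoothNormalField n η ι N) (hφ : IsCoordinateSystem φ) (hψ : IsCoordinateSystem ψ)
    (hpφ : ι p ∈ φ.source) (hpψ : p ∈ ψ.source) (a b : Fin n) :
    η.val (ι p) (covDeriv η ι φ N p (coordVec ψ p b)) (push ι p (coordVec ψ p a)) =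
      η.val (ι p) (covDeriv η ι φ N p (coordVec ψ p a)) (push ι p (coordVec ψ p b)) := by
  have hopen : ∀ᶠ p' in 𝓝 p, ι p' ∈ φ.source :=
    hι.contMDiff.continuous.continuousAt.eventually (φ.open_source.mem_nhds hpφ)
  have key := fun a b ↦ levi_civita_contraction (metricMatrix_symm η φ (ι p))
    (fun k i j ↦ congrArg (fun f ↦ dirDeriv f (ι p) (coordVec φ (ι p) k))
      (funext fun q ↦ metricMatrix_symm η φ q i j))
    (sum_metricMatrix_mul_christoffel η hφ hpφ)
    (dirDeriv_normal hι hN hφ hψ hpφ hpψ a b)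
  rw [metric_eq_sum η hφ hpφ, metric_eq_sum η hφ hpφ]
  simp only [comp_covDeriv hφ hpφ, ← dirDeriv_coordFun hφ hpφ (hι.mdifferentiableAt p)]
  rw [key a b, key b a]
  congr 2
  · refine Finset.sum_congr rfl fun i _ ↦ Finset.sum_congr rfl fun j _ ↦ ?_
    rw [(dirDeriv_dirDeriv_comm hψ hpψ (hopen.mono fun p' hp' ↦
      contMDiffAt_coordFun hφ hp' (hι.contMDiff p') j) a b).2]
  · rw [Finset.sum_comm]
    refine Finset.sum_congr rfl fun j _ ↦ Finset.sum_congr rfl fun k _ ↦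
      Finset.sum_congr rfl fun l _ ↦ ?_
    simp only [metricMatrix_symm η φ _ k j]
    ring

end Submanifold

/-! ### The map `ℬ_N`, the Weingarten map and the normal connection -/

section Submanifold

variable {m n : ℕ}
  {M : Type*} [TopologicalSpace M] [ChartedSpace (Model m) M] [IsManifold (𝓡 m) ∞ M]
  {S : Type*} [TopologicalSpace S] [ChartedSpace (Model n) S]
  {η : PseudoRiemannianMetric m M}
  {ι : S → M} {φ : OpenPartialHomeomorph M (Model m)} {ψ : OpenPartialHomeomorph S (Model n)}
  {N : ∀ p : S, TangentSpace (𝓡 m) (ι p)} {p : S}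

theorem isUnit_det_inducedMatrix (hι : IsPseudoRiemannianSubmanifold n η ι)
    (hψ : IsCoordinateSystem ψ) (hpψ : p ∈ ψ.source) : IsUnit (inducedMatrix η ι ψ p).det := by
  refine isUnit_det_of_nondegenerate fun c hc ↦ ?_
  have : ∑ a, c a • coordVec ψ p a = 0 := by
    refine hι.nondegenerate p _ fun Y ↦ ?_
    rw [← sum_comp_smul hψ hpψ Y]
    simp only [map_sum, map_smul, sum_apply, smul_apply, smul_eq_mul]
    refine Finset.sum_eq_zero fun b _ ↦ ?_
    exact mul_eq_zero_of_right _ (hc b)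
  funext a
  rw [← comp_sum_coordVec hψ hpψ c a, this]
  exact map_zero (mvfderiv (𝓡 n) _ p)

theorem sum_sum_comm {κ κ' : Type*} [Fintype κ] [Fintype κ'] (F : κ → κ → κ' → κ' → ℝ) :
    ∑ k, ∑ l, ∑ a, ∑ b, F k l a b = ∑ a, ∑ b, ∑ k, ∑ l, F k l a b := by
  simp only [← Fintype.sum_prod_type']
  exact Fintype.sum_equiv ⟨fun x ↦ (x.2.2.1, x.2.2.2, x.1, x.2.1),
    fun x ↦ (x.2.2.1, x.2.2.2, x.1, x.2.1), fun _ ↦ rfl, fun _ ↦ rfl⟩ _ _ fun _ ↦ rfl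

/-- The Christoffel term enters through `𝒟^{ik}`, which carries the same factor `g^{ab} e_a^i` as
`𝒟^i`; pulling it out leaves `∇̄_b N`. -/
theorem nablaHat_eq (hι : IsPseudoRiemannianSubmanifold n η ι) (hφ : IsCoordinateSystem φ)
    (hpφ : ι p ∈ φ.source) (i j : Fin m) :
    nablaHat η ι φ ψ N p i j = ∑ a, ∑ b, (inducedMatrix η ι ψ p)⁻¹ a b
      * comp φ (ι p) (push ι p (coordVec ψ p a)) i
      * comp φ (ι p) (covDeriv η ι φ N p (coordVec ψ p b)) j := by
  simp only [comp_covDeriv hφ hpφ, nablaHat, projTensor, projDeriv,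
    dirDeriv_coordFun hφ hpφ (hι.mdifferentiableAt p), mul_add, Finset.sum_add_distrib,
    Finset.mul_sum, Finset.sum_mul]
  congr 1
  rw [sum_sum_comm]
  exact Finset.sum_congr rfl fun a _ ↦ Finset.sum_congr rfl fun b _ ↦
    Finset.sum_congr rfl fun k _ ↦ Finset.sum_congr rfl fun l _ ↦ by ring

/-- `ℬ_N(Y) = -g^{ab} η(∇̄_b N, Y) e_a`. -/
theorem bMap_eq (hι : IsPseudoRiemannianSubmanifold n η ι) (hφ : IsCoordinateSystem φ)
    (hpφ : ι p ∈ φ.source) (Y : TangentSpace (𝓡 m) (ι p)) :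
    bMap η ι φ ψ N p Y = push ι p (∑ a, (-∑ b, (inducedMatrix η ι ψ p)⁻¹ a b
      * η.val (ι p) (covDeriv η ι φ N p (coordVec ψ p b)) Y) • coordVec ψ p a) := by
  refine comp_ext hφ hpφ fun i ↦ ?_
  rw [bMap, comp_sum_coordVec hφ hpφ]
  simp only [map_sum, map_smul, comp_sum, comp_smul, bTensor, nablaHat_eq hι hφ hpφ]
  simp only [metric_eq_sum η hφ hpφ, neg_mul, Finset.sum_neg_distrib, Finset.sum_mul,
    Finset.mul_sum]
  rw [sum_sum_comm]
  exact congrArg _ (Finset.sum_congr rfl fun a _ ↦ Finset.sum_congr rfl fun b _ ↦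
    Finset.sum_congr rfl fun k _ ↦ Finset.sum_congr rfl fun l _ ↦ by ring)

theorem bMap_mem_tangentSub (hι : IsPseudoRiemannianSubmanifold n η ι) (hφ : IsCoordinateSystem φ)
    (hpφ : ι p ∈ φ.source) (Y : TangentSpace (𝓡 m) (ι p)) :
    bMap η ι φ ψ N p Y ∈ tangentSub n ι p := by
  rw [bMap_eq hι hφ hpφ]
  exact ⟨_, rfl⟩

/-- `η(g^{ab} c_b e_a, e_d) = c_d`. -/
theorem metric_push_sum (hι : IsPseudoRiemannianSubmanifold n η ι)
    (hψ : IsCoordinateSystem ψ) (hpψ : p ∈ ψ.source) (c : Fin n → ℝ) (d : Fin n) :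
    η.val (ι p) (push ι p (∑ a, (-∑ b, (inducedMatrix η ι ψ p)⁻¹ a b * c b) • coordVec ψ p a))
      (push ι p (coordVec ψ p d)) = -c d := by
  set g := inducedMatrix η ι ψ p with hg
  have h1 : g * g⁻¹ = 1 := Matrix.mul_nonsing_inv _ (isUnit_det_inducedMatrix hι hψ hpψ)
  have hs : ∀ a, η.val (ι p) (push ι p (coordVec ψ p a)) (push ι p (coordVec ψ p d)) = g d a :=
    fun a ↦ η.symm _ _ _
  simp only [map_sum, map_smul, sum_apply, smul_apply, smul_eq_mul, hs]
  calc ∑ a, (-∑ b, g⁻¹ a b * c b) * g d a = -∑ b, (g * g⁻¹) d b * c b := by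
        simp only [Matrix.mul_apply, Finset.sum_mul, neg_mul, Finset.sum_neg_distrib]
        rw [Finset.sum_comm]
        exact congrArg _ (Finset.sum_congr rfl fun a _ ↦ Finset.sum_congr rfl fun b _ ↦ by ring)
    _ = -c d := by simp [h1, Matrix.one_apply]

/-- `η(ℬ_N(Y), X) = -η(∇̄_X N, Y)` for `X` tangent to the submanifold. -/
theorem metric_bMap_push (hι : IsPseudoRiemannianSubmanifold n η ι) (hφ : IsCoordinateSystem φ)
    (hψ : IsCoordinateSystem ψ) (hpφ : ι p ∈ φ.source) (hpψ : p ∈ ψ.source)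
    (Y : TangentSpace (𝓡 m) (ι p)) (X : TangentSpace (𝓡 n) p) :
    η.val (ι p) (bMap η ι φ ψ N p Y) (push ι p X) =
      -η.val (ι p) (covDeriv η ι φ N p X) Y := by
  have key (a) : η.val (ι p) (bMap η ι φ ψ N p Y) (push ι p (coordVec ψ p a)) =
      -η.val (ι p) (covDeriv η ι φ N p (coordVec ψ p a)) Y := by
    rw [bMap_eq hι hφ hpφ]
    exact metric_push_sum hι hψ hpψ
      (fun b ↦ η.val (ι p) (covDeriv η ι φ N p (coordVec ψ p b)) Y) a
  rw [← sum_comp_smul hψ hpψ X]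
  simp [covDeriv_sum_smul, key]

theorem metric_covDeriv_push_comm (hι : IsPseudoRiemannianSubmanifold n η ι)
    (hN : IsSmoothNormalField n η ι N) (hφ : IsCoordinateSystem φ) (hψ : IsCoordinateSystem ψ)
    (hpφ : ι p ∈ φ.source) (hpψ : p ∈ ψ.source) (X Y : TangentSpace (𝓡 n) p) :
    η.val (ι p) (covDeriv η ι φ N p X) (push ι p Y) =
      η.val (ι p) (covDeriv η ι φ N p Y) (push ι p X) := by
  rw [← sum_comp_smul hψ hpψ X, ← sum_comp_smul hψ hpψ Y]
  simp only [covDeriv_sum_smul, map_sum, map_smul, sum_apply, smul_apply, smul_eq_mul,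
    Finset.mul_sum]
  rw [Finset.sum_comm]
  refine Finset.sum_congr rfl fun a _ ↦ Finset.sum_congr rfl fun b _ ↦ ?_
  rw [metric_covDeriv_push_coordVec hι hN hφ hψ hpφ hpψ]
  ring

/-- `ℬ_N(X)` is tangent and, by the symmetry, `∇̄_X N + ℬ_N(X)` is normal; the splitting into
tangent and normal parts is unique. -/
theorem bMap_push_eq_weingarten (hι : IsPseudoRiemannianSubmanifold n η ι)
    (hN : IsSmoothNormalField n η ι N) (hφ : IsCoordinateSystem φ) (hψ : IsCoordinateSystem ψ)
    (hpφ : ι p ∈ φ.source) (hpψ : p ∈ ψ.source) (X : TangentSpace (𝓡 n) p) :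
    bMap η ι φ ψ N p (push ι p X) = weingarten hι φ N p X := by
  have hn : covDeriv η ι φ N p X + bMap η ι φ ψ N p (push ι p X) ∈ normalSub n η ι p := by
    intro Y
    rw [map_add, add_apply, metric_bMap_push hι hφ hψ hpφ hpψ,
      metric_covDeriv_push_comm hι hN hφ hψ hpφ hpψ X Y]
    ring
  have ht : bMap η ι φ ψ N p (push ι p X) ∈ tangentSub n ι p := bMap_mem_tangentSub hι hφ hpφ _
  have h0 := (Submodule.projectionOnto_apply_eq_zero_iff
    (isCompl_tangentSub_normalSub hι p)).2 hn
  have h1 := Submodule.projectionOnto_apply_left (isCompl_tangentSub_normalSub hι p) ⟨_, ht⟩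
  rw [map_add] at h0
  rw [weingarten, eq_neg_of_add_eq_zero_left h0]
  simp [h1]

theorem metric_normalConnection (hι : IsPseudoRiemannianSubmanifold n η ι)
    (X : TangentSpace (𝓡 n) p) {N' : TangentSpace (𝓡 m) (ι p)} (hN' : N' ∈ normalSub n η ι p) :
    η.val (ι p) (normalConnection hι φ N p X) N' = η.val (ι p) (covDeriv η ι φ N p X) N' := by
  have h : normalConnection hι φ N p X = covDeriv η ι φ N p X - (tangentSub n ι p).projection
      (normalSub n η ι p) (isCompl_tangentSub_normalSub hι p) (covDeriv η ι φ N p X) :=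
    Submodule.projection_eq_self_sub_projection (isCompl_tangentSub_normalSub hι p) _
  obtain ⟨Z, hZ⟩ := Submodule.projection_apply_mem (isCompl_tangentSub_normalSub hι p)
    (covDeriv η ι φ N p X)
  have hZ' : push ι p Z = _ := hZ
  rw [h, ← hZ', map_sub, sub_apply, η.symm _ (push ι p Z), hN' Z, sub_zero]

/-- `V - W` is orthogonal to the normal space by `h` and to the tangent space by normality; these
span, so nondegeneracy of `η` applies. -/
theorem eq_of_mem_normalSub (hι : IsPseudoRiemannianSubmanifold n η ι)
    {V W : TangentSpace (𝓡 m) (ι p)} (hV : V ∈ normalSub n η ι p) (hW : W ∈ normalSub n η ι p)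
    (h : ∀ N' ∈ normalSub n η ι p, η.val (ι p) V N' = η.val (ι p) W N') : V = W := by
  rw [← sub_eq_zero]
  refine η.nondegenerate (ι p) _ fun w ↦ ?_
  have hw : w ∈ tangentSub n ι p ⊔ normalSub n η ι p := by
    rw [(isCompl_tangentSub_normalSub hι p).sup_eq_top]
    trivial
  obtain ⟨_, ⟨X, rfl⟩, N', hN', rfl⟩ := Submodule.mem_sup.1 hw
  have h1 : η.val (ι p) (V - W) (push ι p X) = 0 := sub_mem hV hW X
  rw [map_add, map_sub, sub_apply, sub_apply, h N' hN', sub_self, add_zero]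
  simpa using h1

end Submanifold

/-! ### Hadamard's lemma -/

section Hadamard

variable {E F : Type*} [NormedAddCommGroup E] [NormedSpace ℝ E]
  [NormedAddCommGroup F] [NormedSpace ℝ F]

open MeasureTheory Convolution in
-- The integral is the value at `0` of the convolution of the indicator of `(0, 1]` with `s ↦ χ s •
-- Φ x (-s)`, and convolutions depend smoothly on parameters.
theorem contDiff_intervalIntegral_unit {Φ : E → ℝ → F} (hΦ : ContDiff ℝ ∞ (Function.uncurry Φ)) :
    ContDiff ℝ ∞ fun x ↦ ∫ t in (0 : ℝ)..1, Φ x t := by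
  -- The cutoff gives the compact support that the convolution theorem needs, and equals `1` at the
  -- points `-t` with `t ∈ (0, 1]`.
  let χ : ContDiffBump (0 : ℝ) := ⟨2, 3, by norm_num, by norm_num⟩
  let f : ℝ → ℝ := (Set.Ioc (0 : ℝ) 1).indicator 1
  let g : E → ℝ → F := fun x s ↦ χ s • Φ x (-s)
  have hf : LocallyIntegrable f volume := by
    have : Integrable f volume :=
      (integrable_indicator_iff measurableSet_Ioc).2
        (integrableOn_const (C := (1 : ℝ)) (by simp))
    exact this.locallyIntegrable
  have hg : ContDiff ℝ ∞ (Function.uncurry g) := by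
    refine (χ.contDiff.comp contDiff_snd).smul (hΦ.comp (contDiff_fst.prodMk contDiff_snd.neg))
  have h := contDiffOn_convolution_right_with_param (μ := volume) (n := ⊤)
    (ContinuousLinearMap.lsmul ℝ ℝ) (f := f) (g := g) isOpen_univ
    (isCompact_closedBall (0 : ℝ) 3)
    (fun x s _ hs ↦ by
      have : χ s = 0 := χ.zero_of_le_dist (by
        simp only [Metric.mem_closedBall, not_le] at hs
        exact hs.le)
      simp [g, this]) hf hg.contDiffOn
  rw [Set.univ_prod_univ, contDiffOn_univ] at h
  have h2 := h.comp (contDiff_id.prodMk (contDiff_const (c := (0 : ℝ))))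
  convert h2 using 1
  funext x
  simp only [Function.comp, convolution, ContinuousLinearMap.lsmul_apply, id]
  rw [intervalIntegral.integral_of_le zero_le_one, ← integral_indicator measurableSet_Ioc]
  refine integral_congr_ae (.of_forall fun t ↦ ?_)
  by_cases ht : t ∈ Set.Ioc (0 : ℝ) 1
  · have : χ (0 - t) = 1 := χ.one_of_mem_closedBall (by
      simp only [Metric.mem_closedBall, zero_sub, dist_zero_right, norm_neg, Real.norm_eq_abs]
      change |t| ≤ 2
      rw [abs_of_pos ht.1]
      linarith [ht.2])
    rw [zero_sub] at this
    simp [f, g, ht, this]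
  · simp [f, g, ht]

/-- **Hadamard's lemma**. -/
theorem exists_contDiff_eq_add_apply_sub {f : E → ℝ} (hf : ContDiff ℝ ∞ f) (x₀ : E) :
    ∃ H : E → E →L[ℝ] ℝ, ContDiff ℝ ∞ H ∧ H x₀ = fderiv ℝ f x₀ ∧
      ∀ x, f x = f x₀ + H x (x - x₀) := by
  have hf' : ContDiff ℝ ∞ (fderiv ℝ f) := hf.fderiv_right (by simp)
  -- `H x` is the average of the derivative of `f` over the segment from `x₀` to `x`.
  refine ⟨fun x ↦ ∫ t in (0 : ℝ)..1, fderiv ℝ f (x₀ + t • (x - x₀)),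
    contDiff_intervalIntegral_unit (hf'.comp (by fun_prop)), by simp, fun x ↦ ?_⟩
  have hcont : Continuous fun t : ℝ ↦ fderiv ℝ f (x₀ + t • (x - x₀)) :=
    hf'.continuous.comp (by fun_prop)
  rw [ContinuousLinearMap.intervalIntegral_apply (hcont.intervalIntegrable _ _)]
  have hd : ∀ t ∈ Set.uIcc (0 : ℝ) 1, HasDerivAt (fun t : ℝ ↦ f (x₀ + t • (x - x₀)))
      (fderiv ℝ f (x₀ + t • (x - x₀)) (x - x₀)) t := by
    intro t _
    have h1 : HasDerivAt (fun t : ℝ ↦ x₀ + t • (x - x₀)) (x - x₀) t := by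
      simpa using ((hasDerivAt_id t).smul_const (x - x₀)).const_add x₀
    exact ((hf.differentiable (by simp)) _).hasFDerivAt.comp_hasDerivAt t h1
  rw [intervalIntegral.integral_eq_sub_of_hasDerivAt hd
    ((hcont.clm_apply continuous_const).intervalIntegrable _ _)]
  simp

end Hadamard

/-! ### Point derivations are tangent vectors -/

section Derivations

variable {n : ℕ} {S : Type*} [TopologicalSpace S] [ChartedSpace (Model n) S]  {p : S}

/-- A derivation at `p` of the algebra of smooth functions. -/
structure IsDerivationAt (p : S) (D : C^∞⟮𝓡 n, S; ℝ⟯ →ₗ[ℝ] ℝ) : Prop where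
  leibniz (u v : C^∞⟮𝓡 n, S; ℝ⟯) : D (u * v) = u p * D v + v p * D u

namespace IsDerivationAt

variable {D : C^∞⟮𝓡 n, S; ℝ⟯ →ₗ[ℝ] ℝ}

theorem map_const (hD : IsDerivationAt p D) (c : ℝ) :
    D (algebraMap ℝ C^∞⟮𝓡 n, S; ℝ⟯ c) = 0 := by
  have h1 : D 1 = 0 := by
    have := hD.leibniz 1 1
    simp at this
    exact this
  rw [Algebra.algebraMap_eq_smul_one, map_smul, h1, smul_zero]

end IsDerivationAt

variable [T2Space S] [IsManifold (𝓡 n) ∞ S]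

/-- Multiply by a bump function at `p` supported where `f` is smooth. -/
theorem exists_contMDiffMap_eventuallyEq {f : S → ℝ}
    (hf : ∀ᶠ p' in 𝓝 p, ContMDiffAt (𝓡 n) 𝓘(ℝ, ℝ) ∞ f p') :
    ∃ F : C^∞⟮𝓡 n, S; ℝ⟯, (F : S → ℝ) =ᶠ[𝓝 p] f := by
  obtain ⟨χ, -, hχ⟩ := (SmoothBumpFunction.nhds_basis_tsupport (I := 𝓡 n) p).mem_iff.1 hf
  refine ⟨⟨fun x ↦ χ x • f x, contMDiff_of_tsupport fun x hx ↦ ?_⟩, ?_⟩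
  · exact χ.contMDiffAt.smul (hχ (tsupport_smul_subset_left _ _ hx))
  · filter_upwards [χ.eventuallyEq_one] with x hx
    simp [hx]

theorem germExtension_eventuallyEq {f : S → ℝ}
    (hf : ∀ᶠ p' in 𝓝 p, ContMDiffAt (𝓡 n) 𝓘(ℝ, ℝ) ∞ f p') :
    ((germExtension p f : C^∞⟮𝓡 n, S; ℝ⟯) : S → ℝ) =ᶠ[𝓝 p] f := by
  have h := exists_contMDiffMap_eventuallyEq hf
  rw [germExtension, dif_pos h]
  exact h.choose_spec

namespace IsDerivationAt

variable {D : C^∞⟮𝓡 n, S; ℝ⟯ →ₗ[ℝ] ℝ}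

/-- If a bump function `χ` with `χ p = 1` is supported where `u = v`, then `χ (u - v) = 0`, and the
Leibniz rule at `p` leaves `D (u - v) = 0`. -/
theorem map_eq_of_eventuallyEq (hD : IsDerivationAt p D) {u v : C^∞⟮𝓡 n, S; ℝ⟯}
    (h : (u : S → ℝ) =ᶠ[𝓝 p] v) : D u = D v := by
  obtain ⟨χ, -, hχ⟩ := (SmoothBumpFunction.nhds_basis_tsupport (I := 𝓡 n) p).mem_iff.1 h
  let X : C^∞⟮𝓡 n, S; ℝ⟯ := ⟨χ, χ.contMDiff⟩
  have h0 : X * (u - v) = 0 := by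
    ext x
    change χ x * (u x - v x) = 0
    by_cases hx : χ x = 0
    · simp [hx]
    · have : u x = v x := hχ (subset_tsupport _ hx)
      simp [this]
  have h1 := hD.leibniz X (u - v)
  have hX : X p = 1 := χ.eq_one
  have h2 : (u - v) p = 0 := sub_eq_zero.2 h.eq_of_nhds
  rw [h0, map_zero, hX, h2, map_sub] at h1
  linarith

/-- Near `p`, Hadamard's lemma gives `u = u(p) + ∑ y_a G_a` with `y_a(p) = 0` and `G_a(p) = ∂_a
u(p)`. The Leibniz rule then leaves the coefficients `D(y_a)`, which do not depend on `u`. -/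
theorem exists_eq_sum (hD : IsDerivationAt p D) {ψ : OpenPartialHomeomorph S (Model n)}
    (hψ : IsCoordinateSystem ψ) (hp : p ∈ ψ.source) :
    ∃ c : Fin n → ℝ, ∀ u : C^∞⟮𝓡 n, S; ℝ⟯, D u = ∑ a, c a * dirDeriv u p (coordVec ψ p a) := by
  have hsrc : ∀ᶠ p' in 𝓝 p, p' ∈ ψ.source := ψ.open_source.mem_nhds hp
  have hy (a : Fin n) : ∀ᶠ p' in 𝓝 p,
      ContMDiffAt (𝓡 n) 𝓘(ℝ, ℝ) ∞ (fun p' ↦ ψ p' a - ψ p a) p' :=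
    hsrc.mono fun p' hp' ↦ (contMDiffAt_coord hψ hp' a).sub contMDiffAt_const
  choose y hy using fun a ↦ exists_contMDiffMap_eventuallyEq (hy a)
  refine ⟨fun a ↦ D (y a), fun u ↦ ?_⟩
  obtain ⟨r, hr, hball⟩ := Metric.isOpen_iff.1 ψ.open_target _ (ψ.map_source hp)
  -- The outer radius `r / 2` keeps the support inside `ψ.target`, so `χ` times the coordinate
  -- expression of `u` is smooth on all of `ℝ^n`.
  let χ : ContDiffBump (ψ p) := ⟨r / 3, r / 2, by positivity, by linarith⟩
  let f : Model n → ℝ := fun x ↦ χ x • u (ψ.symm x)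
  have hf : ContDiff ℝ ∞ f := by
    rw [← contMDiff_iff_contDiff]
    refine contMDiff_of_tsupport fun x hx ↦ ?_
    have hx' : x ∈ ψ.target := by
      have := tsupport_smul_subset_left _ _ hx
      rw [χ.tsupport_eq] at this
      exact hball (Metric.closedBall_subset_ball (by change r / 2 < r; linarith) this)
    exact (χ.contDiff.contMDiff x).smul (u.contMDiff.contMDiffAt.comp x (hψ.contMDiffAt_symm hx'))
  have hfu : f =ᶠ[𝓝 (ψ p)] u ∘ ψ.symm := by
    filter_upwards [χ.eventuallyEq_one] with x hx
    simp [f, hx]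
  obtain ⟨H, hH, hH0, hfH⟩ := exists_contDiff_eq_add_apply_sub hf (ψ p)
  have hG (a : Fin n) : ∀ᶠ p' in 𝓝 p, ContMDiffAt (𝓡 n) 𝓘(ℝ, ℝ) ∞
      (fun p' ↦ H (ψ p') (EuclideanSpace.single a (1 : ℝ))) p' :=
    hsrc.mono fun p' hp' ↦ (hH.clm_apply contDiff_const).contMDiff.contMDiffAt.comp p'
      (hψ.contMDiffAt hp')
  choose G hG using fun a ↦ exists_contMDiffMap_eventuallyEq (hG a)
  have hu : (u : S → ℝ) =ᶠ[𝓝 p] (algebraMap ℝ C^∞⟮𝓡 n, S; ℝ⟯ (u p) + ∑ a, y a * G a :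
      C^∞⟮𝓡 n, S; ℝ⟯) := by
    filter_upwards [hsrc, (hψ.contMDiffAt hp).continuousAt.eventually hfu,
      Filter.eventually_all.2 hy, Filter.eventually_all.2 hG] with p' hs h1 h2 h3
    have e1 : u p' = f (ψ p') := by rw [h1, Function.comp, ψ.left_inv hs]
    have e2 : u p = f (ψ p) := by rw [hfu.self_of_nhds, Function.comp, ψ.left_inv hp]
    have e3 : (∑ a, y a * G a : C^∞⟮𝓡 n, S; ℝ⟯) p' = ∑ a, y a p' * G a p' := by
      exact (congrFun (map_sum ContMDiffMap.coeFnAddMonoidHom _ _) p').trans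
        (Finset.sum_apply _ _ _)
    have e4 : ψ p' - ψ p = ∑ a, (ψ p' a - ψ p a) • EuclideanSpace.single a (1 : ℝ) := by
      ext b
      simp [Pi.single_apply]
    change u p' = u p + (∑ a, y a * G a : C^∞⟮𝓡 n, S; ℝ⟯) p'
    rw [e3, e1, e2, hfH (ψ p'), e4]
    simp [h2, h3]
  rw [hD.map_eq_of_eventuallyEq hu, map_add, hD.map_const, zero_add, map_sum]
  refine Finset.sum_congr rfl fun a _ ↦ ?_
  have hy0 : y a p = 0 := by simp [(hy a).self_of_nhds]
  rw [hD.leibniz, hy0, zero_mul, zero_add, mul_comm,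
    dirDeriv_coordVec hψ hp (u.contMDiff.mdifferentiableAt (by simp)), ← hfu.fderiv_eq, ← hH0,
    (hG a).self_of_nhds]

end IsDerivationAt

end Derivations

/-! ### Brackets as tangent vectors and the bracket formula -/

section Brackets

variable {m n : ℕ}
  {M : Type*} [TopologicalSpace M] [ChartedSpace (Model m) M]
  {S : Type*} [TopologicalSpace S] [ChartedSpace (Model n) S] [T2Space S] [IsManifold (𝓡 n) ∞ S]
  {ι : S → M} {φ : OpenPartialHomeomorph M (Model m)} {ψ : OpenPartialHomeomorph S (Model n)}
  {p : S} {r : ℕ}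

omit [T2Space S] [IsManifold (𝓡 n) ∞ S] in
theorem Bracket.isDerivationAt (β : Bracket n S r) (p : S) (f : Fin (r + 1) → C^∞⟮𝓡 n, S; ℝ⟯)
    (k : Fin (r + 1)) :
    IsDerivationAt p ((LinearMap.proj p ∘ₗ ContMDiffMap.coeFnLinearMap) ∘ₗ
      β.toFun.toLinearMap f k) where
  leibniz u v := congrArg (fun F : C^∞⟮𝓡 n, S; ℝ⟯ ↦ F p) (β.leibniz f k u v)

omit [ChartedSpace (Model m) M] in
theorem Bracket.exists_withCoords_eq (β : Bracket n S r) (hψ : IsCoordinateSystem ψ)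
    (hpψ : p ∈ ψ.source) (I : Fin r → Fin m) :
    ∃ c : Fin n → ℝ, ∀ f : S → ℝ, (∀ᶠ p' in 𝓝 p, ContMDiffAt (𝓡 n) 𝓘(ℝ, ℝ) ∞ f p') →
      β.withCoords ι φ p f I = ∑ a, c a * dirDeriv f p (coordVec ψ p a) := by
  obtain ⟨c, hc⟩ := (β.isDerivationAt p
    (Fin.cons 0 fun k ↦ germExtension p (coordFun ι φ (I k))) 0).exists_eq_sum hψ hpψ
  refine ⟨c, fun f hf ↦ ?_⟩
  have h := hc (germExtension p f)
  simp only [dirDeriv_congr (germExtension_eventuallyEq hf)] at h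
  rw [← h]
  change β.toFun _ p = β.toFun _ p
  congr 2
  funext k
  refine Fin.cases ?_ (fun k ↦ ?_) k
  · simp
  · simp

variable [IsManifold (𝓡 m) ∞ M] {η : PseudoRiemannianMetric m M}

omit [T2Space S] [IsManifold (𝓡 n) ∞ S] in
-- The derivatives of the restricted `x^j` are the components of the push-forward, and `dι` is
-- injective.
theorem eq_of_sum_mul_dirDeriv_coordFun (hι : IsPseudoRiemannianSubmanifold n η ι)
    (hφ : IsCoordinateSystem φ) (hψ : IsCoordinateSystem ψ) (hpφ : ι p ∈ φ.source)
    (hpψ : p ∈ ψ.source) {A B : Fin n → ℝ}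
    (h : ∀ j, ∑ a, A a * dirDeriv (coordFun ι φ j) p (coordVec ψ p a) =
      ∑ a, B a * dirDeriv (coordFun ι φ j) p (coordVec ψ p a)) : A = B := by
  have key : ∑ a, A a • coordVec ψ p a = ∑ a, B a • coordVec ψ p a := by
    refine hι.injective p (comp_ext hφ hpφ fun j ↦ ?_)
    simp only [map_sum, map_smul, comp_sum, comp_smul]
    simpa only [dirDeriv_coordFun hφ hpφ (hι.mdifferentiableAt p)] using h j
  funext a
  rw [← comp_sum_coordVec hψ hpψ A a, key, comp_sum_coordVec hψ hpψ]

/-- `𝒟^i(f) = ε / (γ² r!) {x^i, x^I} {f, x^J} η_{IJ}`. -/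
theorem projDeriv_eq_bracket (hι : IsPseudoRiemannianSubmanifold n η ι)
    (hφ : IsCoordinateSystem φ) (hψ : IsCoordinateSystem ψ) (hpφ : ι p ∈ φ.source)
    (hpψ : p ∈ ψ.source) {β : Bracket n S r} {γ : C^∞⟮𝓡 n, S; ℝ⟯} {ε : ℝ}
    (hβ : β.IsCompatible η ι γ ε) (i : Fin m) {f : S → ℝ}
    (hf : ∀ᶠ p' in 𝓝 p, ContMDiffAt (𝓡 n) 𝓘(ℝ, ℝ) ∞ f p') :
    projDeriv η ι φ ψ p i f = ε / (γ p ^ 2 * (r.factorial : ℝ)) *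
      ∑ I : Fin r → Fin m, ∑ J : Fin r → Fin m, β.withCoords ι φ p (coordFun ι φ i) I *
        β.withCoords ι φ p f J * multiMetric η φ (ι p) I J := by
  choose c hc using fun J ↦ β.exists_withCoords_eq (ι := ι) (φ := φ) hψ hpψ J
  have hx (j : Fin m) : ∀ᶠ p' in 𝓝 p, ContMDiffAt (𝓡 n) 𝓘(ℝ, ℝ) ∞ (coordFun ι φ j) p' :=
    (hι.contMDiff.continuous.continuousAt.eventually (φ.open_source.mem_nhds hpφ)).mono
      fun p' hp' ↦ contMDiffAt_coordFun hφ hp' (hι.contMDiff p') j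
  set W : (Fin r → Fin m) → ℝ := fun I ↦ β.withCoords ι φ p (coordFun ι φ i) I with hW
  -- `A` and `B` are the components of the tangent vectors that represent the bracket expression and
  -- `𝒟^i`.
  let A : Fin n → ℝ := fun a ↦ ε / (γ p ^ 2 * (r.factorial : ℝ)) *
    ∑ I : Fin r → Fin m, ∑ J : Fin r → Fin m, W I * c J a * multiMetric η φ (ι p) I J
  let B : Fin n → ℝ := fun b ↦ ∑ a, (inducedMatrix η ι ψ p)⁻¹ a b *
    dirDeriv (coordFun ι φ i) p (coordVec ψ p a)
  have hA (f : S → ℝ) (hf : ∀ᶠ p' in 𝓝 p, ContMDiffAt (𝓡 n) 𝓘(ℝ, ℝ) ∞ f p') :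
      ∑ a, A a * dirDeriv f p (coordVec ψ p a) = ε / (γ p ^ 2 * (r.factorial : ℝ)) *
        ∑ I : Fin r → Fin m, ∑ J : Fin r → Fin m, W I *
          β.withCoords ι φ p f J * multiMetric η φ (ι p) I J := by
    simp only [A, hc _ f hf, Finset.mul_sum, Finset.sum_mul]
    rw [Finset.sum_comm]
    refine Finset.sum_congr rfl fun I _ ↦ ?_
    rw [Finset.sum_comm]
    exact Finset.sum_congr rfl fun J _ ↦ Finset.sum_congr rfl fun a _ ↦ by ring
  have hB (f : S → ℝ) : projDeriv η ι φ ψ p i f =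
      ∑ a, B a * dirDeriv f p (coordVec ψ p a) := by
    simp only [projDeriv, B, Finset.sum_mul]
    exact Finset.sum_comm
  have hAB : A = B := by
    refine eq_of_sum_mul_dirDeriv_coordFun hι hφ hψ hpφ hpψ fun j ↦ ?_
    rw [hA _ (hx j), ← hB]
    have hrel := hβ.relation φ hφ ψ hψ p hpφ hpψ i j
    have hγ : γ p ≠ 0 := (hβ.pos p).ne'
    -- Since `ε` is its own inverse, it can appear in the numerator of the formula.
    have hε : ε * ε = 1 := by rcases hβ.sign with h | h <;> simp [h]
    have hr : (r.factorial : ℝ) ≠ 0 := by positivity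
    have hs : 1 / √(r.factorial : ℝ) * (1 / √(r.factorial : ℝ)) = 1 / (r.factorial : ℝ) := by
      rw [div_mul_div_comm, one_mul, Real.mul_self_sqrt (by positivity)]
    have hP : ∑ I : Fin r → Fin m, ∑ J : Fin r → Fin m,
        β.P ι φ p i I * β.P ι φ p j J * multiMetric η φ (ι p) I J = 1 / (r.factorial : ℝ) *
        ∑ I : Fin r → Fin m, ∑ J : Fin r → Fin m, W I *
          β.withCoords ι φ p (coordFun ι φ j) J * multiMetric η φ (ι p) I J := by
      simp only [Finset.mul_sum, ← hs, Bracket.P, hW]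
      exact Finset.sum_congr rfl fun I _ ↦ Finset.sum_congr rfl fun J _ ↦ by ring
    rw [hP] at hrel
    change _ = projTensor η ι φ ψ p i j
    calc _ = ε / γ p ^ 2 * (1 / (r.factorial : ℝ) *
        ∑ I : Fin r → Fin m, ∑ J : Fin r → Fin m, W I *
          β.withCoords ι φ p (coordFun ι φ j) J * multiMetric η φ (ι p) I J) := by
          rw [← mul_assoc, div_mul_div_comm, mul_one]
      _ = (ε * ε) * projTensor η ι φ ψ p i j := by rw [hrel]; field_simp
      _ = projTensor η ι φ ψ p i j := by rw [hε, one_mul]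
  rw [hB, ← hAB, hA f hf]

/-- `∇̂^i N^j` involves `𝒟^i` only through `𝒟^i(N^j)` and `𝒟^i(x^k)`, and `projDeriv_eq_bracket`
covers both. -/
theorem bTensor_eq_bracket (hι : IsPseudoRiemannianSubmanifold n η ι)
    {N : ∀ p : S, TangentSpace (𝓡 m) (ι p)} (hN : IsSmoothNormalField n η ι N)
    (hφ : IsCoordinateSystem φ) (hψ : IsCoordinateSystem ψ) (hpφ : ι p ∈ φ.source)
    (hpψ : p ∈ ψ.source) {β : Bracket n S r} {γ : C^∞⟮𝓡 n, S; ℝ⟯} {ε : ℝ}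
    (hβ : β.IsCompatible η ι γ ε) (i j : Fin m) :
    bTensor η ι φ ψ N p i j =
      -(ε / (γ p ^ 2 * (r.factorial : ℝ)) *
        ∑ I : Fin r → Fin m, ∑ J : Fin r → Fin m, β.withCoords ι φ p (coordFun ι φ i) I *
          β.withCoords ι φ p (fieldComp ι φ N j) J * multiMetric η φ (ι p) I J)
      - ε / (γ p ^ 2 * (r.factorial : ℝ)) *
        ∑ I : Fin r → Fin m, ∑ J : Fin r → Fin m, ∑ k, ∑ l,
          β.withCoords ι φ p (coordFun ι φ i) I * β.withCoords ι φ p (coordFun ι φ k) J *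
          multiMetric η φ (ι p) I J * christoffel η φ (ι p) j k l * fieldComp ι φ N l p := by
  have hopen := hι.contMDiff.continuous.continuousAt.eventually (φ.open_source.mem_nhds hpφ)
  have h1 := projDeriv_eq_bracket hι hφ hψ hpφ hpψ hβ i
    (hopen.mono fun p' hp' ↦ contMDiffAt_fieldComp hφ hp' (hN.contMDiff p') j)
  have h2 (k : Fin m) := projDeriv_eq_bracket hι hφ hψ hpφ hpψ hβ i
    (hopen.mono fun p' hp' ↦ contMDiffAt_coordFun hφ hp' (hι.contMDiff p') k)
  rw [bTensor, nablaHat, h1, neg_add, ← sub_eq_add_neg]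
  congr 1
  simp only [projTensor, h2, Finset.mul_sum, Finset.sum_mul]
  rw [sum_sum_comm]
  exact Finset.sum_congr rfl fun a _ ↦ Finset.sum_congr rfl fun b _ ↦
    Finset.sum_congr rfl fun k _ ↦ Finset.sum_congr rfl fun l _ ↦ by ring

end Brackets

end BracketGeometry

end

theorem mainTheorem6 {m n : ℕ}
    {M : Type*} [TopologicalSpace M] [ChartedSpace (BracketGeometry.Model m) M]
    [IsManifold (𝓡 m) ∞ M]
    {S : Type*} [TopologicalSpace S] [T2Space S] [ChartedSpace (BracketGeometry.Model n) S]
    [IsManifold (𝓡 n) ∞ S]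
    (η : BracketGeometry.PseudoRiemannianMetric m M) (ι : S → M)
    (hι : BracketGeometry.IsPseudoRiemannianSubmanifold n η ι)
    (N : ∀ p : S, TangentSpace (𝓡 m) (ι p)) (hN : BracketGeometry.IsSmoothNormalField n η ι N)
    (φ : OpenPartialHomeomorph M (BracketGeometry.Model m))
    (hφ : BracketGeometry.IsCoordinateSystem φ)
    (ψ : OpenPartialHomeomorph S (BracketGeometry.Model n))
    (hψ : BracketGeometry.IsCoordinateSystem ψ)
    (p : S) (hpφ : ι p ∈ φ.source) (hpψ : p ∈ ψ.source) :
    -- the expression of `ℬ_N^{ij}` in terms of any compatible bracket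
    (∀ (r : ℕ) (β : BracketGeometry.Bracket n S r) (γ : C^∞⟮𝓡 n, S; ℝ⟯) (ε : ℝ),
      β.IsCompatible η ι γ ε → ∀ i j : Fin m,
        BracketGeometry.bTensor η ι φ ψ N p i j =
          -(ε / (γ p ^ 2 * (r.factorial : ℝ)) *
            ∑ I : Fin r → Fin m, ∑ J : Fin r → Fin m,
              β.withCoords ι φ p (BracketGeometry.coordFun ι φ i) I *
              β.withCoords ι φ p (BracketGeometry.fieldComp ι φ N j) J *
              BracketGeometry.multiMetric η φ (ι p) I J)
          - ε / (γ p ^ 2 * (r.factorial : ℝ)) *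
            ∑ I : Fin r → Fin m, ∑ J : Fin r → Fin m, ∑ k, ∑ l,
              β.withCoords ι φ p (BracketGeometry.coordFun ι φ i) I *
              β.withCoords ι φ p (BracketGeometry.coordFun ι φ k) J *
              BracketGeometry.multiMetric η φ (ι p) I J *
              BracketGeometry.christoffel η φ (ι p) j k l *
              BracketGeometry.fieldComp ι φ N l p) ∧
    -- `ℬ_N` takes values in the tangent space of the submanifold
    (∀ Y : TangentSpace (𝓡 m) (ι p),
      BracketGeometry.bMap η ι φ ψ N p Y ∈ BracketGeometry.tangentSub n ι p) ∧
    -- `ℬ_N(X) = W_N(X)`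
    (∀ X : TangentSpace (𝓡 n) p,
      BracketGeometry.bMap η ι φ ψ N p (BracketGeometry.push ι p X) =
        BracketGeometry.weingarten hι φ N p X) ∧
    -- `η(ℬ_N(Ñ), X) = -η(D_X N, Ñ)`
    (∀ (X : TangentSpace (𝓡 n) p), ∀ N' ∈ BracketGeometry.normalSub n η ι p,
      η.val (ι p) (BracketGeometry.bMap η ι φ ψ N p N') (BracketGeometry.push ι p X) =
        -η.val (ι p) (BracketGeometry.normalConnection hι φ N p X) N') ∧
    -- this relation determines the normal connection
    (∀ (X : TangentSpace (𝓡 n) p), ∀ V ∈ BracketGeometry.normalSub n η ι p,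
      (∀ N' ∈ BracketGeometry.normalSub n η ι p,
        η.val (ι p) (BracketGeometry.bMap η ι φ ψ N p N') (BracketGeometry.push ι p X) =
          -η.val (ι p) V N') →
      V = BracketGeometry.normalConnection hι φ N p X) := by
  exact ⟨fun r β γ ε hβ i j ↦ BracketGeometry.bTensor_eq_bracket hι hN hφ hψ hpφ hpψ hβ i j,
    BracketGeometry.bMap_mem_tangentSub hι hφ hpφ,
    BracketGeometry.bMap_push_eq_weingarten hι hN hφ hψ hpφ hpψ,
    fun X N' hN' ↦ by
      rw [BracketGeometry.metric_bMap_push hι hφ hψ hpφ hpψ,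
        BracketGeometry.metric_normalConnection hι X hN'],
    fun X V hV h ↦ BracketGeometry.eq_of_mem_normalSub hι hV (Subtype.prop _) fun N' hN' ↦ by
      have := h N' hN'
      rw [BracketGeometry.metric_bMap_push hι hφ hψ hpφ hpψ] at this
      rw [BracketGeometry.metric_normalConnection hι X hN']
      exact (neg_inj.1 this).symm⟩
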